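/- Let $n,m,r\in\mathbb N$, $T>0$, $B\in\mathbb R^{n\times m}$, $C\in\mathbb R^{r\times n}$, $x_0\in\mathbb R^n$ and $y\in L^2(0,T;\mathbb R^r)$ be fixed. For a symmetric positive definite matrix $W$ put $\|x\|_W=\sqrt{x^\top Wx}$, and let $\|\cdot\|$ be the spectral norm of matrices. **Uncertain system.** Let $\Sigma_A,\Sigma_\Gamma,\Sigma_R,\Sigma_Q$ be finite nonempty subsets of $\mathbb R^{s_A},\mathbb R^{s_\Gamma},\mathbb R^{s_R},\mathbb R^{s_Q}$, let $\Sigma=\Sigma_A\times\Sigma_\Gamma\times\Sigma_R\times\Sigma_Q$ carry the uniform probability, and let $N=|\Sigma|$. For $\sigma=(\sigma_A,\sigma_\Gamma,\sigma_R,\sigma_Q)\in\Sigma$ let $\mathcal S_\sigma=(A_\sigma,\Gamma_\sigma,R_\sigma,Q_\sigma)\in\mathbb R^{n\times n}\times\mathbb R^{n\times n}\times\mathbb R^{m\times m}\times\mathbb R^{r\times r}$, where each of the four matrices is a function of the corresponding component of $\sigma$ and $\Gamma_\sigma,R_\sigma,Q_\sigma$ are symmetric positive definite. Differences of such tuples are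 taken componentwise, and $\|(A,\Gamma,R,Q)\|_1=\|A\|+\|\Gamma\|+\|R\|+\|Q\|$. For $f:\Sigma\to\mathbb R$ write $\mathbb E[f(\sigma)]=\frac1N\sum_{\sigma\in\Sigma}f(\sigma)$. **Kalman filters.** For $\sigma\in\Sigma$ let $\Pi_\sigma$ be the solution on $[0,T]$ of $$\dot\Pi_\sigma=A_\sigma\Pi_\sigma+\Pi_\sigma A_\sigma^\top-\Pi_\sigma C^\top Q_\sigma^{-1}C\,\Pi_\sigma+BR_\sigma B^\top,\qquad \Pi_\sigma(0)=\Gamma_\sigma,$$ let $P_\sigma(t)=\Pi_\sigma(t)^{-1}$, and let $\widehat x_\sigma\in H^1(0,T;\mathbb R^n)$ be the solution of $$\dot{\widehat x}_\sigma=A_\sigma\widehat x_\sigma+\Pi_\sigma C^\top Q_\sigma^{-1}(y-C\widehat x_\sigma),\qquad \widehat x_\sigma(0)=x_0 .$$ **Expected energy.** For $t\in(0,T]$ and $\xi\in\mathbb R^n$ let $$\mathcal V_\sigma(t,\xi)=\inf_{x,v}\ \tfrac12\|x(0)-x_0\|_{\Gamma_\sigma^{-1}}^2+\tfrac12\int_0^t\|v(s)\|_{R_\sigma^{-1}}^2+\|y(s)-Cx(s)\|_{Q_\sigma^{-1}}^2\,\mathrm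 ds,$$ where the infimum is over all $x\in H^1(0,t;\mathbb R^n)$, $v\in L^2(0,t;\mathbb R^m)$ with $\dot x=A_\sigma x+Bv$ on $(0,t)$ and $x(t)=\xi$; and let $\mathcal V_\sigma(0,\xi)=\frac12\|\xi-x_0\|_{\Gamma_\sigma^{-1}}^2$. Put $E(t,\xi)=\mathbb E[\mathcal V_\sigma(t,\xi)]$ and $\widehat x_{\mathrm E}(t)=\arg\min_{\xi\in\mathbb R^n}E(t,\xi)$. **Proposition.** For every $M$ there is a constant $c_{\mathrm E}>0$, depending only on $T,B,C,x_0,y$ and $M$ (in particular independent of $N$), such that the following holds for every uncertain system with $\|A_\sigma\|,\|\Gamma_\sigma\|,\|R_\sigma\|,\|\Gamma_\sigma^{-1}\|,\|Q_\sigma^{-1}\|\le M$ for all $\sigma\in\Sigma$. For every $\sigma\in\Sigma$ the solutions $\Pi_\sigma$ and $\widehat x_\sigma$ exist on $[0,T]$, and $\Pi_\sigma(t)$ is positive definite for all $t\in[0,T]$; for every $t\in[0,T]$ the function $E(t,\cdot)$ has exactly one minimizer $\widehat x_{\mathrm E}(t)$; and for every (true, hidden) parameter $\bar\sigma\in\Sigma$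 and all $t\in[0,T]$ $$\|\widehat x_{\mathrm E}(t)-\widehat x_{\bar\sigma}(t)\|_{P_{\bar\sigma}(t)}\ \le\ c_{\mathrm E}\;\mathbb E\big[\|\mathcal S_\sigma-\mathcal S_{\bar\sigma}\|_1\big].$$ -/

import Mathlib

open Set MeasureTheory
open scoped Matrix Matrix.Norms.L2Operator

namespace UncertainKalman

/-- The weighted norm `‖x‖_M = √(xᵀ M x)` for a symmetric positive definite `M`. -/
noncomputable def wnorm {d : ℕ} (M : Matrix (Fin d) (Fin d) ℝ) (x : Fin d → ℝ) : ℝ :=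
  Real.sqrt (x ⬝ᵥ (M *ᵥ x))

/-- `v ∈ L²(a, b; ℝᵈ)`. -/
def MemL2 {d : ℕ} (a b : ℝ) (v : ℝ → Fin d → ℝ) : Prop :=
  MemLp v 2 (volume.restrict (Ioo a b))

/-- `x` is (the continuous representative of) an element of `H¹(a, b; ℝᵈ)`, and its weak
derivative is `x'`. -/
def HasH1Deriv {d : ℕ} (a b : ℝ) (x x' : ℝ → Fin d → ℝ) : Prop :=
  MemL2 a b x' ∧ ∀ s ∈ Icc a b, x s = x a + ∫ τ in a..s, x' τ

/-- The certain part of the model: time horizon, noise input matrix, observation matrix,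
undisturbed initial state and measured output. -/
structure Setting (n m r : ℕ) where
  T : ℝ
  B : Matrix (Fin n) (Fin m) ℝ
  C : Matrix (Fin r) (Fin n) ℝ
  x₀ : Fin n → ℝ
  y : ℝ → Fin r → ℝ

/-- A four-tuple `S = (A, Γ, R, Q)` of a system matrix and three covariance matrices. -/
structure SystemData (n m r : ℕ) where
  A : Matrix (Fin n) (Fin n) ℝ
  Γ : Matrix (Fin n) (Fin n) ℝ
  R : Matrix (Fin m) (Fin m) ℝ
  Q : Matrix (Fin r) (Fin r) ℝ

instance {n m r : ℕ} : Sub (SystemData n m r) :=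
  ⟨fun S S' => ⟨S.A - S'.A, S.Γ - S'.Γ, S.R - S'.R, S.Q - S'.Q⟩⟩

/-- `‖S‖₁ = ‖A‖ + ‖Γ‖ + ‖R‖ + ‖Q‖`, with spectral norms of the matrices. -/
noncomputable def SystemData.norm1 {n m r : ℕ} (S : SystemData n m r) : ℝ :=
  ‖S.A‖ + ‖S.Γ‖ + ‖S.R‖ + ‖S.Q‖

/-- A bound on the data and on the inverses of `Γ` and `Q`. -/
def SystemData.BoundedBy {n m r : ℕ} (S : SystemData n m r) (M : ℝ) : Prop :=
  ‖S.A‖ ≤ M ∧ ‖S.Γ‖ ≤ M ∧ ‖S.R‖ ≤ M ∧ ‖S.Γ⁻¹‖ ≤ M ∧ ‖S.Q⁻¹‖ ≤ M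

namespace Setting

variable {n m r : ℕ} (D : Setting n m r) (S : SystemData n m r)

/-- `Π` solves, on `[0, T]`, the differential Riccati equation
`Π' = A Π + Π Aᵀ - Π Cᵀ Q⁻¹ C Π + B R Bᵀ`, `Π(0) = Γ`. -/
def IsRiccatiSolution (P : ℝ → Matrix (Fin n) (Fin n) ℝ) : Prop :=
  P 0 = S.Γ ∧ ∀ t ∈ Icc 0 D.T,
    HasDerivWithinAt P
      (S.A * P t + P t * S.Aᵀ - P t * D.Cᵀ * S.Q⁻¹ * D.C * P t + D.B * S.R * D.Bᵀ)
      (Icc 0 D.T) t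

/-- The error covariance `Π` of the Kalman filter. -/
noncomputable def errorCov : ℝ → Matrix (Fin n) (Fin n) ℝ :=
  Classical.epsilon (D.IsRiccatiSolution S)

/-- The precision matrix `P(t) = Π(t)⁻¹`. -/
noncomputable def precision (t : ℝ) : Matrix (Fin n) (Fin n) ℝ :=
  (D.errorCov S t)⁻¹

/-- `x ∈ H¹(0, T; ℝⁿ)` solves the Kalman filter equation
`x' = A x + Π Cᵀ Q⁻¹ (y - C x)`, `x(0) = x₀`. -/
def IsKalmanTrajectory (x : ℝ → Fin n → ℝ) : Prop :=
  x 0 = D.x₀ ∧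
    HasH1Deriv 0 D.T x (fun t =>
      S.A *ᵥ x t + (D.errorCov S t * D.Cᵀ * S.Q⁻¹) *ᵥ (D.y t - D.C *ᵥ x t))

/-- The Kalman filter. -/
noncomputable def kalmanFilter : ℝ → Fin n → ℝ :=
  Classical.epsilon (D.IsKalmanTrajectory S)

/-- `x ∈ H¹(0, t; ℝⁿ)` and `v ∈ L²(0, t; ℝᵐ)` satisfy `x' = A x + B v` on `(0, t)`
and `x(t) = ξ`. -/
def Admissible (t : ℝ) (ξ : Fin n → ℝ) (x : ℝ → Fin n → ℝ) (v : ℝ → Fin m → ℝ) : Prop :=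
  MemL2 0 t v ∧ HasH1Deriv 0 t x (fun s => S.A *ᵥ x s + D.B *ᵥ v s) ∧ x t = ξ

/-- The energy `J(x, v; t)` of the disturbances. -/
noncomputable def cost (t : ℝ) (x : ℝ → Fin n → ℝ) (v : ℝ → Fin m → ℝ) : ℝ :=
  1 / 2 * wnorm S.Γ⁻¹ (x 0 - D.x₀) ^ 2 +
    1 / 2 * ∫ s in (0 : ℝ)..t, (wnorm S.R⁻¹ (v s) ^ 2 + wnorm S.Q⁻¹ (D.y s - D.C *ᵥ x s) ^ 2)

open Classical in
/-- The value function `V(t, ξ)`: the least energy that takes the system to `ξ` at time `t`. -/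
noncomputable def valueFunction (t : ℝ) (ξ : Fin n → ℝ) : ℝ :=
  if t = 0 then 1 / 2 * wnorm S.Γ⁻¹ (ξ - D.x₀) ^ 2
  else sInf {J : ℝ | ∃ x v, D.Admissible S t ξ x v ∧ J = D.cost S t x v}

end Setting

/-- Uncertain system and covariance matrices: four matrix-valued functions of parameters,
with four finite nonempty sets of possible parameter values. -/
structure UncertainSystem (n m r : ℕ) where
  sA : ℕ
  sΓ : ℕ
  sR : ℕ
  sQ : ℕ
  setA : Finset (Fin sA → ℝ)
  setΓ : Finset (Fin sΓ → ℝ)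
  setR : Finset (Fin sR → ℝ)
  setQ : Finset (Fin sQ → ℝ)
  setA_nonempty : setA.Nonempty
  setΓ_nonempty : setΓ.Nonempty
  setR_nonempty : setR.Nonempty
  setQ_nonempty : setQ.Nonempty
  matA : (Fin sA → ℝ) → Matrix (Fin n) (Fin n) ℝ
  matΓ : (Fin sΓ → ℝ) → Matrix (Fin n) (Fin n) ℝ
  matR : (Fin sR → ℝ) → Matrix (Fin m) (Fin m) ℝ
  matQ : (Fin sQ → ℝ) → Matrix (Fin r) (Fin r) ℝ
  posDef_matΓ : ∀ σ ∈ setΓ, (matΓ σ).PosDef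
  posDef_matR : ∀ σ ∈ setR, (matR σ).PosDef
  posDef_matQ : ∀ σ ∈ setQ, (matQ σ).PosDef

namespace UncertainSystem

variable {n m r : ℕ} (U : UncertainSystem n m r)

/-- The finite parameter set `Σ = Σ_A × Σ_Γ × Σ_R × Σ_Q`. -/
abbrev Param : Type :=
  ↥U.setA × ↥U.setΓ × ↥U.setR × ↥U.setQ

/-- `S_σ = (A_σ, Γ_σ, R_σ, Q_σ)`. -/
def data (σ : U.Param) : SystemData n m r :=
  ⟨U.matA σ.1, U.matΓ σ.2.1, U.matR σ.2.2.1, U.matQ σ.2.2.2⟩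

/-- Expectation with respect to the uniform probability on the `N` elements of `Σ`. -/
noncomputable def expect (f : U.Param → ℝ) : ℝ :=
  1 / (Fintype.card U.Param : ℝ) * ∑ σ : U.Param, f σ

/-- The expected energy `E(t, ξ)`. -/
noncomputable def expectedEnergy (D : Setting n m r) (t : ℝ) (ξ : Fin n → ℝ) : ℝ :=
  U.expect fun σ => D.valueFunction (U.data σ) t ξ

/-- `ξ` minimizes the expected energy at time `t`. -/
def IsEnergyMinimizer (D : Setting n m r) (t : ℝ) (ξ : Fin n → ℝ) : Prop :=
  IsMinOn (U.expectedEnergy D t) univ ξ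

/-- The estimator that minimizes the expected energy. -/
noncomputable def energyEstimator (D : Setting n m r) (t : ℝ) : Fin n → ℝ :=
  Classical.epsilon (U.IsEnergyMinimizer D t)

end UncertainSystem

end UncertainKalman

namespace UncertainKalman

/-! Completing the square along trajectories shows that each value function is an exact quadratic,
`V_σ(t, ξ) = ½ ‖ξ - x̂_σ(t)‖²_{P_σ(t)} + const` (`Setting.valueFunction_eq`). The expected energy is
thus a mean of positive definite quadratics, and its unique minimizer `η` is determined by `∑ P_σ (η
- x̂_σ) = 0`. Testing this equation with `d = η - x̂_σbar` gives `∑ d·P_σ d = ∑ d·P_σ (x̂_σ -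
x̂_σbar)`. If the `P_σ` are uniformly coercive and bounded, `‖d‖` is at most a constant times the
mean of `‖x̂_σ - x̂_σbar‖` (`norm_sub_le_of_gradient_eq_zero`). It remains to bound `Π_σ` and `P_σ`
uniformly and to show that `x̂_σ(t)` is Lipschitz in the data, uniformly in `t`.

All of this is read off explicit formulas. With `W = B R Bᵀ` and `K = Cᵀ Q⁻¹ C`, let `(X, Y)` solve
the linear Hamiltonian system `X' = A X + W Y`, `Y' = K X - Aᵀ Y` from `(Γ, 1)`. Then `Π = X Y⁻¹`,
`P = Y X⁻¹` and `x̂ = Y⁻ᵀ (x₀ + ∫ Xᵀ Cᵀ Q⁻¹ y)`. The form `Yw·Xw` is nondecreasing in time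
(`dotProduct_le_hamY_hamX`), hence bounded below by `w·Γw`. This single inequality makes `X` and `Y`
invertible, so that the Riccati solution exists on all of `[0, T]`; it makes `Π` positive definite,
and it bounds `Y⁻¹` by `M ‖X‖` and `X⁻¹` by `M ‖Y‖`. As the matrix exponential is Lipschitz on
bounded sets, sums, products, inverses and integrals preserve the required bounds (`LipBdd`). -/

/-! ### Absolutely continuous functions on an interval. -/

theorem intervalIntegrable_of_mem {E : Type*} [NormedAddCommGroup E] {a b c : ℝ} {f : ℝ → E}
    (hf : IntervalIntegrable f volume a b) (hc : c ∈ Icc a b) :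
    IntervalIntegrable f volume a c := by
  refine hf.mono_set ?_
  rw [uIcc_of_le hc.1, uIcc_of_le (hc.1.trans hc.2)]
  exact Icc_subset_Icc_right hc.2

/-- `f` is absolutely continuous on `[a, b]`: it is the primitive of the integrable function
`f'`. -/
def IsPrimitiveOn (a b : ℝ) (f f' : ℝ → ℝ) : Prop :=
  IntervalIntegrable f' volume a b ∧ ∀ s ∈ Icc a b, f s = f a + ∫ τ in a..s, f' τ

namespace IsPrimitiveOn

variable {a b : ℝ} {f g f' g' : ℝ → ℝ}

theorem mono (hf : IsPrimitiveOn a b f f') {c : ℝ} (hc : c ∈ Icc a b) :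
    IsPrimitiveOn a c f f' :=
  ⟨intervalIntegrable_of_mem hf.1 hc, fun s hs => hf.2 s ⟨hs.1, hs.2.trans hc.2⟩⟩

theorem absolutelyContinuous_primitive (hf' : IntervalIntegrable f' volume a b)
    (c : ℝ) : AbsolutelyContinuousOnInterval (fun s => c + ∫ τ in a..s, f' τ) a b := by
  have h1 := hf'.absolutelyContinuousOnInterval_intervalIntegral (c := a) left_mem_uIcc
  have h2 : AbsolutelyContinuousOnInterval (fun _ : ℝ => c) a b :=
    (contDiff_const (𝕜 := ℝ) (n := 1)).contDiffOn.absolutelyContinuousOnInterval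
  exact h2.add h1

theorem continuousOn (hab : a ≤ b) (hf : IsPrimitiveOn a b f f') : ContinuousOn f (Icc a b) := by
  have := (absolutelyContinuous_primitive hf.1 (f a)).continuousOn
  rw [uIcc_of_le hab] at this
  exact this.congr hf.2

theorem add (hf : IsPrimitiveOn a b f f') (hg : IsPrimitiveOn a b g g') :
    IsPrimitiveOn a b (fun s => f s + g s) (fun s => f' s + g' s) := by
  refine ⟨hf.1.add hg.1, fun s hs => ?_⟩
  rw [intervalIntegral.integral_add (intervalIntegrable_of_mem hf.1 hs)
    (intervalIntegrable_of_mem hg.1 hs)]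
  linarith [hf.2 s hs, hg.2 s hs]

theorem const_mul (c : ℝ) (hf : IsPrimitiveOn a b f f') :
    IsPrimitiveOn a b (fun s => c * f s) (fun s => c * f' s) := by
  refine ⟨hf.1.const_mul c, fun s hs => ?_⟩
  rw [intervalIntegral.integral_const_mul]
  linear_combination c * hf.2 s hs

theorem const (c : ℝ) : IsPrimitiveOn a b (fun _ => c) (fun _ => 0) :=
  ⟨intervalIntegrable_const, fun s _ => by simp⟩

theorem sub (hf : IsPrimitiveOn a b f f') (hg : IsPrimitiveOn a b g g') :
    IsPrimitiveOn a b (fun s => f s - g s) (fun s => f' s - g' s) := by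
  simpa [sub_eq_add_neg] using hf.add (hg.const_mul (-1))

theorem sum {ι : Type*} (u : Finset ι) {F F' : ι → ℝ → ℝ}
    (h : ∀ i ∈ u, IsPrimitiveOn a b (F i) (F' i)) :
    IsPrimitiveOn a b (fun s => ∑ i ∈ u, F i s) (fun s => ∑ i ∈ u, F' i s) := by
  classical
  induction u using Finset.induction_on with
  | empty => simpa using const 0
  | insert i u hi ih =>
    simp only [Finset.sum_insert hi]
    exact (h i (Finset.mem_insert_self i u)).add
      (ih fun j hj => h j (Finset.mem_insert_of_mem hj))

theorem congr {h h' : ℝ → ℝ} (hab : a ≤ b) (hf : IsPrimitiveOn a b f f')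
    (h1 : ∀ s ∈ Icc a b, h s = f s) (h2 : ∀ s ∈ Icc a b, h' s = f' s) :
    IsPrimitiveOn a b h h' := by
  refine ⟨hf.1.congr fun s hs => ?_, fun s hs => ?_⟩
  · rw [uIoc_of_le hab] at hs
    exact (h2 s ⟨hs.1.le, hs.2⟩).symm
  · rw [h1 s hs, h1 a ⟨le_rfl, hab⟩, hf.2 s hs]
    congr 1
    refine intervalIntegral.integral_congr fun τ hτ => ?_
    rw [uIcc_of_le hs.1] at hτ
    exact (h2 τ ⟨hτ.1, hτ.2.trans hs.2⟩).symm

theorem of_hasDerivAt (hab : a ≤ b) (h : ∀ s ∈ Icc a b, HasDerivAt f (f' s) s)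
    (hc : ContinuousOn f' (Icc a b)) : IsPrimitiveOn a b f f' := by
  have hi : IntervalIntegrable f' volume a b :=
    ContinuousOn.intervalIntegrable (by rwa [uIcc_of_le hab])
  refine ⟨hi, fun s hs => ?_⟩
  rw [intervalIntegral.integral_eq_sub_of_hasDerivAt (fun τ hτ => ?_)
    (intervalIntegrable_of_mem hi hs)]
  · ring
  · rw [uIcc_of_le hs.1] at hτ
    exact h τ ⟨hτ.1, hτ.2.trans hs.2⟩

/-- The product rule for absolutely continuous functions. -/
theorem mul (hab : a ≤ b) (hf : IsPrimitiveOn a b f f') (hg : IsPrimitiveOn a b g g') :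
    IsPrimitiveOn a b (fun s => f s * g s) (fun s => f' s * g s + f s * g' s) := by
  have hi : IntervalIntegrable (fun s => f' s * g s + f s * g' s) volume a b := by
    refine (hf.1.mul_continuousOn ?_).add (hg.1.continuousOn_mul ?_)
    · rw [uIcc_of_le hab]; exact hg.continuousOn hab
    · rw [uIcc_of_le hab]; exact hf.continuousOn hab
  refine ⟨hi, ?_⟩
  -- The primitives `F`, `G` replace `f`, `g`, which are controlled only on `[a, b]`. The difference
  -- `F * G - I` is absolutely continuous with derivative zero almost everywhere, hence constant.
  set F : ℝ → ℝ := fun s => f a + ∫ τ in a..s, f' τ with hF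
  set G : ℝ → ℝ := fun s => g a + ∫ τ in a..s, g' τ with hG
  set I : ℝ → ℝ := fun s => 0 + ∫ τ in a..s, (f' τ * g τ + f τ * g' τ) with hI
  have hFc : AbsolutelyContinuousOnInterval F a b := absolutelyContinuous_primitive hf.1 _
  have hGc : AbsolutelyContinuousOnInterval G a b := absolutelyContinuous_primitive hg.1 _
  have hIc : AbsolutelyContinuousOnInterval I a b := absolutelyContinuous_primitive hi _
  have hz : ∃ C, ∀ x ∈ uIcc a b, (F * G - I) x = C := by
    refine AbsolutelyContinuousOnInterval.const_of_ae_hasDerivAt_zero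
      ((hFc.mul hGc).sub hIc) ?_
    filter_upwards [hf.1.ae_hasDerivAt_integral, hg.1.ae_hasDerivAt_integral,
      hi.ae_hasDerivAt_integral] with x h1 h2 h3 hx
    have hx' : x ∈ Icc a b := by rwa [uIcc_of_le hab] at hx
    have e1 := ((h1 hx a left_mem_uIcc).const_add (f a))
    have e2 := ((h2 hx a left_mem_uIcc).const_add (g a))
    have e3 := ((h3 hx a left_mem_uIcc).const_add 0)
    have := (e1.mul e2).sub e3
    convert this using 1
    rw [hf.2 x hx', hg.2 x hx']
    ring
  obtain ⟨C, hC⟩ := hz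
  rw [uIcc_of_le hab] at hC
  intro s hs
  have h1 := hC s hs
  have h2 := hC a ⟨le_rfl, hab⟩
  simp only [hF, hG, hI, Pi.sub_apply, Pi.mul_apply, intervalIntegral.integral_same] at h1 h2
  rw [← hf.2 s hs, ← hg.2 s hs] at h1
  change f s * g s = f a * g a + _
  linarith

theorem mulVec {p q : ℕ} (hab : a ≤ b) {G G' : ℝ → Matrix (Fin p) (Fin q) ℝ}
    {x x' : ℝ → Fin q → ℝ}
    (hG : ∀ i j, IsPrimitiveOn a b (fun s => G s i j) (fun s => G' s i j))
    (hx : ∀ j, IsPrimitiveOn a b (fun s => x s j) (fun s => x' s j)) (i : Fin p) :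
    IsPrimitiveOn a b (fun s => (G s *ᵥ x s) i) (fun s => (G' s *ᵥ x s + G s *ᵥ x' s) i) := by
  simp only [Matrix.mulVec, dotProduct, Pi.add_apply, ← Finset.sum_add_distrib]
  exact sum _ fun j _ => (hG i j).mul hab (hx j)

theorem dotProduct {q : ℕ} (hab : a ≤ b) {z z' x x' : ℝ → Fin q → ℝ}
    (hz : ∀ j, IsPrimitiveOn a b (fun s => z s j) (fun s => z' s j))
    (hx : ∀ j, IsPrimitiveOn a b (fun s => x s j) (fun s => x' s j)) :
    IsPrimitiveOn a b (fun s => z s ⬝ᵥ x s) (fun s => z' s ⬝ᵥ x s + z s ⬝ᵥ x' s) := by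
  simp only [_root_.dotProduct, ← Finset.sum_add_distrib]
  exact sum _ fun j _ => (hz j).mul hab (hx j)

end IsPrimitiveOn

/-! ### Square integrable and `H¹` vector functions. -/

section Square

variable {d p : ℕ} {a b : ℝ}

theorem MemL2.intervalIntegrable (hab : a ≤ b) {v : ℝ → Fin d → ℝ} (hv : MemL2 a b v) :
    IntervalIntegrable v volume a b := by
  rw [intervalIntegrable_iff_integrableOn_Ioo_of_le hab]
  exact hv.integrable (by norm_num)

theorem MemL2.mono {v : ℝ → Fin d → ℝ} (hv : MemL2 a b v) {c : ℝ} (hc : c ≤ b) :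
    MemL2 a c v :=
  MemLp.mono_measure (Measure.restrict_mono (Ioo_subset_Ioo_right hc) le_rfl) hv

theorem MemL2.add {v w : ℝ → Fin d → ℝ} (hv : MemL2 a b v) (hw : MemL2 a b w) :
    MemL2 a b (fun s => v s + w s) := MemLp.add hv hw

theorem MemL2.sub {v w : ℝ → Fin d → ℝ} (hv : MemL2 a b v) (hw : MemL2 a b w) :
    MemL2 a b (fun s => v s - w s) := MemLp.sub hv hw

theorem MemL2.of_continuousOn {v : ℝ → Fin d → ℝ} (hv : ContinuousOn v (Icc a b)) :
    MemL2 a b v := by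
  obtain ⟨K, hK⟩ := isCompact_Icc.exists_bound_of_continuousOn hv
  refine MemLp.of_bound ((hv.mono Ioo_subset_Icc_self).aestronglyMeasurable measurableSet_Ioo) K ?_
  filter_upwards [ae_restrict_mem measurableSet_Ioo] with s hs
  exact hK s (Ioo_subset_Icc_self hs)

/-- Multiplication of a matrix with a vector, as a continuous bilinear map. -/
noncomputable def mulVecCLM (p q : ℕ) :
    Matrix (Fin p) (Fin q) ℝ →L[ℝ] (Fin q → ℝ) →L[ℝ] (Fin p → ℝ) :=
  (Matrix.mulVecBilin ℝ ℝ).toContinuousBilinearMap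

theorem MemL2.mulVec {G : ℝ → Matrix (Fin p) (Fin d) ℝ} {v : ℝ → Fin d → ℝ}
    (hG : ContinuousOn G (Icc a b)) (hv : MemL2 a b v) : MemL2 a b (fun s => G s *ᵥ v s) := by
  obtain ⟨K, hK⟩ := isCompact_Icc.exists_bound_of_continuousOn hG
  -- Matrices carry the spectral norm but vectors the sup norm, so the norm of the bilinear map
  -- enters as a factor.
  refine MemLp.of_le_mul (c := ‖mulVecCLM p d‖ * K) hv ?_ ?_
  · exact (mulVecCLM p d).aestronglyMeasurable_comp₂
      ((hG.mono Ioo_subset_Icc_self).aestronglyMeasurable measurableSet_Ioo)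
      hv.aestronglyMeasurable
  · filter_upwards [ae_restrict_mem measurableSet_Ioo] with s hs
    refine ((mulVecCLM p d).le_opNorm₂ _ _).trans ?_
    gcongr
    exact hK s (Ioo_subset_Icc_self hs)

theorem MemL2.intervalIntegrable_dotProduct (hab : a ≤ b) {v w : ℝ → Fin d → ℝ}
    (hv : MemL2 a b v) (hw : MemL2 a b w) :
    IntervalIntegrable (fun s => v s ⬝ᵥ w s) volume a b := by
  rw [intervalIntegrable_iff_integrableOn_Ioo_of_le hab]
  simp only [dotProduct]
  refine integrable_finsetSum _ fun i _ => ?_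
  have h1 := (ContinuousLinearMap.proj (R := ℝ) (φ := fun _ : Fin d => ℝ) i).comp_memLp' hv
  have h2 := (ContinuousLinearMap.proj (R := ℝ) (φ := fun _ : Fin d => ℝ) i).comp_memLp' hw
  exact MemLp.integrable_mul h1 h2

theorem HasH1Deriv.isPrimitiveOn (hab : a ≤ b) {x x' : ℝ → Fin d → ℝ} (h : HasH1Deriv a b x x')
    (i : Fin d) : IsPrimitiveOn a b (fun s => x s i) (fun s => x' s i) := by
  have hi := h.1.intervalIntegrable hab
  let π := ContinuousLinearMap.proj (R := ℝ) (φ := fun _ : Fin d => ℝ) i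
  refine ⟨⟨π.integrable_comp hi.1, π.integrable_comp hi.2⟩, fun s hs => ?_⟩
  have hi' := intervalIntegrable_of_mem hi hs
  refine (congrFun (h.2 s hs) i).trans (congrArg (x a i + ·) ?_)
  exact (π.intervalIntegral_comp_comm hi').symm

theorem HasH1Deriv.of_isPrimitiveOn (hab : a ≤ b) {x x' : ℝ → Fin d → ℝ} (hx' : MemL2 a b x')
    (h : ∀ i, IsPrimitiveOn a b (fun s => x s i) (fun s => x' s i)) : HasH1Deriv a b x x' := by
  refine ⟨hx', fun s hs => ?_⟩
  have hi := hx'.intervalIntegrable hab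
  have hi' := intervalIntegrable_of_mem hi hs
  ext i
  let π := ContinuousLinearMap.proj (R := ℝ) (φ := fun _ : Fin d => ℝ) i
  exact ((h i).2 s hs).trans (congrArg (x a i + ·) (π.intervalIntegral_comp_comm hi'))

theorem HasH1Deriv.continuousOn (hab : a ≤ b) {x x' : ℝ → Fin d → ℝ} (h : HasH1Deriv a b x x') :
    ContinuousOn x (Icc a b) :=
  continuousOn_pi.2 fun i => (h.isPrimitiveOn hab i).continuousOn hab

theorem isPrimitiveOn_entry (hab : a ≤ b) {G G' : ℝ → Matrix (Fin p) (Fin d) ℝ}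
    (h : ∀ s ∈ Icc a b, HasDerivAt G (G' s) s) (hc : ContinuousOn G' (Icc a b)) (i : Fin p)
    (j : Fin d) : IsPrimitiveOn a b (fun s => G s i j) (fun s => G' s i j) := by
  let π := (Matrix.entryLinearMap ℝ ℝ i j : Matrix (Fin p) (Fin d) ℝ →ₗ[ℝ] ℝ).toContinuousLinearMap
  exact .of_hasDerivAt hab (fun s hs => π.hasFDerivAt.comp_hasDerivAt s (h s hs))
    (π.continuous.comp_continuousOn hc)

end Square

/-! ### The linear Hamiltonian flow. -/

section Hamiltonian

variable {n : ℕ} (A Γ W K : Matrix (Fin n) (Fin n) ℝ)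

/-- The matrix of the Hamiltonian system `X' = A X + W Y`, `Y' = K X - Aᵀ Y`. -/
def hamiltonian : Matrix (Fin n ⊕ Fin n) (Fin n ⊕ Fin n) ℝ :=
  Matrix.fromBlocks A W K (-Aᵀ)

/-- The first component of the solution of the Hamiltonian system with initial value `(Γ, 1)`. -/
noncomputable def hamX (t : ℝ) : Matrix (Fin n) (Fin n) ℝ :=
  (NormedSpace.exp (t • hamiltonian A W K)).toBlocks₁₁ * Γ +
    (NormedSpace.exp (t • hamiltonian A W K)).toBlocks₁₂

/-- The second component of the solution of the Hamiltonian system with initial value `(Γ, 1)`. -/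
noncomputable def hamY (t : ℝ) : Matrix (Fin n) (Fin n) ℝ :=
  (NormedSpace.exp (t • hamiltonian A W K)).toBlocks₂₁ * Γ +
    (NormedSpace.exp (t • hamiltonian A W K)).toBlocks₂₂

theorem hamX_zero : hamX A Γ W K 0 = Γ := by
  rw [hamX, zero_smul, NormedSpace.exp_zero, ← Matrix.fromBlocks_one,
    Matrix.toBlocks_fromBlocks₁₁, Matrix.toBlocks_fromBlocks₁₂, one_mul, add_zero]

theorem hamY_zero : hamY A Γ W K 0 = 1 := by
  rw [hamY, zero_smul, NormedSpace.exp_zero, ← Matrix.fromBlocks_one,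
    Matrix.toBlocks_fromBlocks₂₁, Matrix.toBlocks_fromBlocks₂₂, zero_mul, zero_add]

theorem hasDerivAt_linearMap_comp {E F : Type*} [NormedAddCommGroup E] [NormedSpace ℝ E]
    [FiniteDimensional ℝ E] [NormedAddCommGroup F] [NormedSpace ℝ F] (L : E →ₗ[ℝ] F) {f : ℝ → E}
    {f' : E} {t : ℝ} (h : HasDerivAt f f' t) : HasDerivAt (fun s => L (f s)) (L f') t :=
  L.toContinuousLinearMap.hasFDerivAt.comp_hasDerivAt t h

theorem hasDerivAt_exp_hamiltonian (t : ℝ) :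
    HasDerivAt (fun s : ℝ => NormedSpace.exp (s • hamiltonian A W K))
      (hamiltonian A W K * NormedSpace.exp (t • hamiltonian A W K)) t := by
  have : CompleteSpace (Matrix (Fin n ⊕ Fin n) (Fin n ⊕ Fin n) ℝ) :=
    FiniteDimensional.complete ℝ _
  exact hasDerivAt_exp_smul_const' (hamiltonian A W K) t

theorem hasDerivAt_hamX (t : ℝ) :
    HasDerivAt (hamX A Γ W K) (A * hamX A Γ W K t + W * hamY A Γ W K t) t := by
  -- The component is a linear image of the exponential, so its derivative is the same image of `H *
  -- exp (t • H)`; the first block row of `H` gives the equation.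
  let L : Matrix (Fin n ⊕ Fin n) (Fin n ⊕ Fin n) ℝ →ₗ[ℝ] Matrix (Fin n) (Fin n) ℝ :=
    { toFun := fun E => E.toBlocks₁₁ * Γ + E.toBlocks₁₂
      map_add' := fun E F => by
        have h1 : (E + F).toBlocks₁₁ = E.toBlocks₁₁ + F.toBlocks₁₁ := rfl
        have h2 : (E + F).toBlocks₁₂ = E.toBlocks₁₂ + F.toBlocks₁₂ := rfl
        rw [h1, h2, add_mul]; abel
      map_smul' := fun c E => by
        have h1 : (c • E).toBlocks₁₁ = c • E.toBlocks₁₁ := rfl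
        have h2 : (c • E).toBlocks₁₂ = c • E.toBlocks₁₂ := rfl
        rw [h1, h2, smul_mul_assoc, smul_add]; rfl }
  have h := hasDerivAt_linearMap_comp L (hasDerivAt_exp_hamiltonian A W K t)
  refine HasDerivAt.congr_deriv h ?_
  rw [hamX, hamY]
  generalize NormedSpace.exp (t • hamiltonian A W K) = E
  change (hamiltonian A W K * E).toBlocks₁₁ * Γ + (hamiltonian A W K * E).toBlocks₁₂ = _
  rw [← Matrix.fromBlocks_toBlocks E, hamiltonian, Matrix.fromBlocks_multiply]
  simp only [Matrix.toBlocks_fromBlocks₁₁, Matrix.toBlocks_fromBlocks₁₂,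
    Matrix.toBlocks_fromBlocks₂₁, Matrix.toBlocks_fromBlocks₂₂]
  noncomm_ring

theorem hasDerivAt_hamY (t : ℝ) :
    HasDerivAt (hamY A Γ W K) (K * hamX A Γ W K t - Aᵀ * hamY A Γ W K t) t := by
  let L : Matrix (Fin n ⊕ Fin n) (Fin n ⊕ Fin n) ℝ →ₗ[ℝ] Matrix (Fin n) (Fin n) ℝ :=
    { toFun := fun E => E.toBlocks₂₁ * Γ + E.toBlocks₂₂
      map_add' := fun E F => by
        have h1 : (E + F).toBlocks₂₁ = E.toBlocks₂₁ + F.toBlocks₂₁ := rfl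
        have h2 : (E + F).toBlocks₂₂ = E.toBlocks₂₂ + F.toBlocks₂₂ := rfl
        rw [h1, h2, add_mul]; abel
      map_smul' := fun c E => by
        have h1 : (c • E).toBlocks₂₁ = c • E.toBlocks₂₁ := rfl
        have h2 : (c • E).toBlocks₂₂ = c • E.toBlocks₂₂ := rfl
        rw [h1, h2, smul_mul_assoc, smul_add]; rfl }
  have h := hasDerivAt_linearMap_comp L (hasDerivAt_exp_hamiltonian A W K t)
  refine HasDerivAt.congr_deriv h ?_
  rw [hamX, hamY]
  generalize NormedSpace.exp (t • hamiltonian A W K) = E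
  change (hamiltonian A W K * E).toBlocks₂₁ * Γ + (hamiltonian A W K * E).toBlocks₂₂ = _
  rw [← Matrix.fromBlocks_toBlocks E, hamiltonian, Matrix.fromBlocks_multiply]
  simp only [Matrix.toBlocks_fromBlocks₁₁, Matrix.toBlocks_fromBlocks₁₂,
    Matrix.toBlocks_fromBlocks₂₁, Matrix.toBlocks_fromBlocks₂₂]
  noncomm_ring

end Hamiltonian

/-! ### Derivatives of transposes and inverses; coercivity. -/

section MatrixCalculus

variable {n p q : ℕ}

theorem hasDerivAt_transpose {G : ℝ → Matrix (Fin p) (Fin q) ℝ} {G' : Matrix (Fin p) (Fin q) ℝ}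
    {t : ℝ} (h : HasDerivAt G G' t) : HasDerivAt (fun s => (G s)ᵀ) G'ᵀ t :=
  hasDerivAt_linearMap_comp (Matrix.transposeLinearEquiv (Fin p) (Fin q) ℝ ℝ).toLinearMap h

theorem hasDerivAt_matrix_inv {G : ℝ → Matrix (Fin n) (Fin n) ℝ} {G' : Matrix (Fin n) (Fin n) ℝ}
    {t : ℝ} (h : HasDerivAt G G' t) (hu : IsUnit (G t)) :
    HasDerivAt (fun s => (G s)⁻¹) (-((G t)⁻¹ * G' * (G t)⁻¹)) t := by
  have : CompleteSpace (Matrix (Fin n) (Fin n) ℝ) := FiniteDimensional.complete ℝ _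
  obtain ⟨u, hu⟩ := hu
  have h1 := hasFDerivAt_ringInverse (𝕜 := ℝ) u
  rw [hu] at h1
  have h2 := h1.comp_hasDerivAt t h
  have h3 : (↑u⁻¹ : Matrix (Fin n) (Fin n) ℝ) = (G t)⁻¹ := by
    rw [← hu, Matrix.coe_units_inv]
  refine (HasDerivAt.congr_of_eventuallyEq h2
    (Filter.Eventually.of_forall fun s => ?_)).congr_deriv ?_
  · exact Matrix.nonsing_inv_eq_ringInverse _
  · simp [h3]

end MatrixCalculus

theorem norm_toLp_sq {d : ℕ} (w : Fin d → ℝ) :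
    ‖WithLp.toLp 2 w‖ * ‖WithLp.toLp 2 w‖ = w ⬝ᵥ w := by
  rw [← real_inner_self_eq_norm_mul_norm, EuclideanSpace.inner_eq_star_dotProduct]
  simp

/-- A positive definite matrix is bounded below by the inverse of the norm of its inverse. -/
theorem dotProduct_le_of_norm_inv_le {n : ℕ} {Γ : Matrix (Fin n) (Fin n) ℝ} (hΓ : Γ.PosDef)
    {M : ℝ} (hM : 0 < M) (h : ‖Γ⁻¹‖ ≤ M) (w : Fin n → ℝ) : w ⬝ᵥ w ≤ M * (w ⬝ᵥ (Γ *ᵥ w)) := by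
  have hu : IsUnit Γ.det := (Matrix.isUnit_iff_isUnit_det Γ).1 hΓ.isUnit
  have hs : Γᵀ = Γ := Matrix.isHermitian_iff_isSymm.1 hΓ.isHermitian
  have h1 : w ⬝ᵥ (Γ⁻¹ *ᵥ w) ≤ M * (w ⬝ᵥ w) := by
    have e1 := real_inner_le_norm (WithLp.toLp 2 w) (WithLp.toLp 2 (Γ⁻¹ *ᵥ w))
    have e2 := Matrix.l2_opNorm_mulVec Γ⁻¹ (WithLp.toLp 2 w)
    have e4 : inner ℝ (WithLp.toLp 2 w) (WithLp.toLp 2 (Γ⁻¹ *ᵥ w)) = w ⬝ᵥ (Γ⁻¹ *ᵥ w) := by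
      simp [EuclideanSpace.inner_eq_star_dotProduct, dotProduct_comm]
    rw [e4] at e1
    rw [← norm_toLp_sq]
    calc _ ≤ _ := e1
      _ ≤ ‖WithLp.toLp 2 w‖ * (‖Γ⁻¹‖ * ‖WithLp.toLp 2 w‖) := by gcongr; exact e2
      _ ≤ ‖WithLp.toLp 2 w‖ * (M * ‖WithLp.toLp 2 w‖) := by gcongr
      _ = _ := by ring
  set z := Γ⁻¹ *ᵥ w with hz
  have hΓz : Γ *ᵥ z = w := by
    rw [hz, Matrix.mulVec_mulVec, Matrix.mul_nonsing_inv _ hu, Matrix.one_mulVec]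
  -- With `z = Γ⁻¹ w` this expands to `0 ≤ w·Γw - 2 M⁻¹ w·w + M⁻² w·z`. Since `w·z ≤ M w·w`, the
  -- last term absorbs one of the two copies of `M⁻¹ w·w`.
  have h2 : 0 ≤ (w - M⁻¹ • z) ⬝ᵥ (Γ *ᵥ (w - M⁻¹ • z)) := by
    simpa using hΓ.posSemidef.dotProduct_mulVec_nonneg (w - M⁻¹ • z)
  have h3 : z ⬝ᵥ (Γ *ᵥ w) = w ⬝ᵥ w := by
    rw [Matrix.dotProduct_mulVec, ← Matrix.mulVec_transpose, hs, hΓz]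
  rw [Matrix.mulVec_sub, Matrix.mulVec_smul, hΓz, sub_dotProduct, dotProduct_sub, dotProduct_sub,
    smul_dotProduct, smul_dotProduct, dotProduct_smul, dotProduct_smul, h3, dotProduct_comm z w]
    at h2
  simp only [smul_eq_mul] at h2
  have h4 : M⁻¹ * (M⁻¹ * (w ⬝ᵥ z)) ≤ M⁻¹ * (w ⬝ᵥ w) := by
    gcongr
    rw [inv_mul_le_iff₀ hM]
    exact h1
  have h5 : M⁻¹ * (w ⬝ᵥ w) ≤ w ⬝ᵥ (Γ *ᵥ w) := by linarith
  rwa [inv_mul_le_iff₀ hM] at h5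

/-! ### From the Hamiltonian flow to the Riccati equation. -/

section Definite

variable {n : ℕ} {A Γ W K : Matrix (Fin n) (Fin n) ℝ}

/-- The flow is symplectic: `YᵀX - XᵀY` has derivative zero, and at time `0` it equals `Γ - Γᵀ = 0`.
The symmetry of `Π` comes from here. -/
theorem transpose_hamY_mul_hamX_symm (hΓ : Γᵀ = Γ) (hW : Wᵀ = W) (hK : Kᵀ = K) (t : ℝ) :
    (hamY A Γ W K t)ᵀ * hamX A Γ W K t = (hamX A Γ W K t)ᵀ * hamY A Γ W K t := by
  have hd : ∀ s, HasDerivAt (fun s => (hamY A Γ W K s)ᵀ * hamX A Γ W K s -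
      (hamX A Γ W K s)ᵀ * hamY A Γ W K s) 0 s := fun s => by
    have hX := hasDerivAt_hamX A Γ W K s
    have hY := hasDerivAt_hamY A Γ W K s
    have h := ((hasDerivAt_transpose hY).mul hX).sub ((hasDerivAt_transpose hX).mul hY)
    refine HasDerivAt.congr_deriv h ?_
    simp only [Matrix.transpose_add, Matrix.transpose_sub, Matrix.transpose_mul,
      Matrix.transpose_transpose, hW, hK]
    noncomm_ring
  have h := is_const_of_deriv_eq_zero (fun s => (hd s).differentiableAt)
    (fun s => (hd s).deriv) t 0
  simp only [hamX_zero, hamY_zero, hΓ, Matrix.transpose_one, one_mul, mul_one, sub_self] at h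
  exact sub_eq_zero.1 h

/-- The `A` terms cancel in the derivative of `Yw·Xw`, leaving `Xw·K(Xw) + Yw·W(Yw) ≥ 0`; the value
at time `0` is `w·Γw`. Invertibility, definiteness and all uniform bounds on inverses rest on this
inequality. -/
theorem dotProduct_le_hamY_hamX (hW : W.PosSemidef) (hK : K.PosSemidef) {t : ℝ} (ht : 0 ≤ t)
    (w : Fin n → ℝ) :
    w ⬝ᵥ (Γ *ᵥ w) ≤ (hamY A Γ W K t *ᵥ w) ⬝ᵥ (hamX A Γ W K t *ᵥ w) := by
  have hWs : Wᵀ = W := Matrix.isHermitian_iff_isSymm.1 hW.isHermitian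
  have hKs : Kᵀ = K := Matrix.isHermitian_iff_isSymm.1 hK.isHermitian
  let L : Matrix (Fin n) (Fin n) ℝ →ₗ[ℝ] ℝ :=
    { toFun := fun G => w ⬝ᵥ (G *ᵥ w)
      map_add' := fun E F => by rw [Matrix.add_mulVec, dotProduct_add]
      map_smul' := fun c E => by rw [Matrix.smul_mulVec, dotProduct_smul]; rfl }
  have hd : ∀ s, HasDerivAt (fun s => w ⬝ᵥ (((hamY A Γ W K s)ᵀ * hamX A Γ W K s) *ᵥ w))
      ((hamX A Γ W K s *ᵥ w) ⬝ᵥ (K *ᵥ (hamX A Γ W K s *ᵥ w)) +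
        (hamY A Γ W K s *ᵥ w) ⬝ᵥ (W *ᵥ (hamY A Γ W K s *ᵥ w))) s := fun s => by
    have hX := hasDerivAt_hamX A Γ W K s
    have hY := hasDerivAt_hamY A Γ W K s
    have h := hasDerivAt_linearMap_comp L ((hasDerivAt_transpose hY).mul hX)
    refine HasDerivAt.congr_deriv h ?_
    change w ⬝ᵥ (_ *ᵥ w) = _
    have e : ∀ G H : Matrix (Fin n) (Fin n) ℝ,
        (G *ᵥ w) ⬝ᵥ (H *ᵥ (G *ᵥ w)) = w ⬝ᵥ ((Gᵀ * H * G) *ᵥ w) := fun G H => by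
      rw [← Matrix.mulVec_mulVec, ← Matrix.mulVec_mulVec, Matrix.dotProduct_mulVec w Gᵀ,
        Matrix.vecMul_transpose]
    rw [e, e, ← dotProduct_add, ← Matrix.add_mulVec]
    congr 2
    simp only [Matrix.transpose_sub, Matrix.transpose_mul, Matrix.transpose_transpose, hKs]
    noncomm_ring
  have hm : Monotone (fun s => w ⬝ᵥ (((hamY A Γ W K s)ᵀ * hamX A Γ W K s) *ᵥ w)) := by
    refine monotone_of_deriv_nonneg (fun s => (hd s).differentiableAt) fun s => ?_
    rw [(hd s).deriv]
    refine add_nonneg ?_ ?_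
    · simpa using hK.dotProduct_mulVec_nonneg (hamX A Γ W K s *ᵥ w)
    · simpa using hW.dotProduct_mulVec_nonneg (hamY A Γ W K s *ᵥ w)
  have h := hm ht
  simp only [hamX_zero, hamY_zero, Matrix.transpose_one, one_mul] at h
  rw [← Matrix.mulVec_mulVec, Matrix.dotProduct_mulVec w (hamY A Γ W K t)ᵀ,
    Matrix.vecMul_transpose] at h
  exact h

theorem isUnit_of_mulVec_ne_zero {G : Matrix (Fin n) (Fin n) ℝ}
    (h : ∀ w, w ≠ 0 → G *ᵥ w ≠ 0) : IsUnit G := by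
  rw [← Matrix.mulVec_injective_iff_isUnit]
  intro u v huv
  by_contra hne
  refine h (u - v) (sub_ne_zero.2 hne) ?_
  rw [Matrix.mulVec_sub, sub_eq_zero]
  exact huv

theorem isUnit_hamY (hΓ : Γ.PosDef) (hW : W.PosSemidef) (hK : K.PosSemidef) {t : ℝ} (ht : 0 ≤ t) :
    IsUnit (hamY A Γ W K t) := by
  refine isUnit_of_mulVec_ne_zero fun w hw h0 => ?_
  have h1 := dotProduct_le_hamY_hamX (A := A) (Γ := Γ) hW hK ht w
  have h2 : 0 < w ⬝ᵥ (Γ *ᵥ w) := by simpa using hΓ.dotProduct_mulVec_pos hw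
  rw [h0, zero_dotProduct] at h1
  exact absurd h1 (not_le.2 h2)

theorem isUnit_hamX (hΓ : Γ.PosDef) (hW : W.PosSemidef) (hK : K.PosSemidef) {t : ℝ} (ht : 0 ≤ t) :
    IsUnit (hamX A Γ W K t) := by
  refine isUnit_of_mulVec_ne_zero fun w hw h0 => ?_
  have h1 := dotProduct_le_hamY_hamX (A := A) (Γ := Γ) hW hK ht w
  have h2 : 0 < w ⬝ᵥ (Γ *ᵥ w) := by simpa using hΓ.dotProduct_mulVec_pos hw
  rw [h0, dotProduct_zero] at h1
  exact absurd h1 (not_le.2 h2)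

variable (A Γ W K) in
/-- The solution `Π = X Y⁻¹` of the Riccati equation. -/
noncomputable def riccati (t : ℝ) : Matrix (Fin n) (Fin n) ℝ :=
  hamX A Γ W K t * (hamY A Γ W K t)⁻¹

theorem riccati_inv (hΓ : Γ.PosDef) (hW : W.PosSemidef) (hK : K.PosSemidef) {t : ℝ}
    (ht : 0 ≤ t) : (riccati A Γ W K t)⁻¹ = hamY A Γ W K t * (hamX A Γ W K t)⁻¹ := by
  have hY := (Matrix.isUnit_iff_isUnit_det _).1 (isUnit_hamY (A := A) hΓ hW hK ht)
  rw [riccati, Matrix.mul_inv_rev, Matrix.nonsing_inv_nonsing_inv _ hY]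

/-- Substituting `w = Y u` turns `w·X Y⁻¹ w` into `Yu·Xu ≥ u·Γu > 0`. Symmetry is the identity `YᵀX
= XᵀY` multiplied by `Y⁻ᵀ` and `Y⁻¹`. -/
theorem riccati_posDef (hΓ : Γ.PosDef) (hW : W.PosSemidef) (hK : K.PosSemidef) {t : ℝ}
    (ht : 0 ≤ t) : (riccati A Γ W K t).PosDef := by
  have hYu := isUnit_hamY (A := A) hΓ hW hK ht
  have hY := (Matrix.isUnit_iff_isUnit_det _).1 hYu
  have hs := transpose_hamY_mul_hamX_symm (A := A) (Γ := Γ) (W := W) (K := K)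
    (Matrix.isHermitian_iff_isSymm.1 hΓ.isHermitian)
    (Matrix.isHermitian_iff_isSymm.1 hW.isHermitian)
    (Matrix.isHermitian_iff_isSymm.1 hK.isHermitian) t
  have hle := dotProduct_le_hamY_hamX (A := A) (Γ := Γ) hW hK ht
  rw [riccati]
  generalize hamX A Γ W K t = X at *
  generalize hamY A Γ W K t = Y at *
  have hYT : IsUnit Yᵀ.det := by rwa [Matrix.det_transpose]
  refine Matrix.PosDef.of_dotProduct_mulVec_pos ?_ fun w hw => ?_
  · rw [Matrix.IsHermitian, Matrix.conjTranspose_eq_transpose_of_trivial, Matrix.transpose_mul,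
      Matrix.transpose_nonsing_inv]
    calc Yᵀ⁻¹ * Xᵀ = Yᵀ⁻¹ * (Xᵀ * Y) * Y⁻¹ := by
          rw [← mul_assoc, mul_assoc _ Y, Matrix.mul_nonsing_inv _ hY, mul_one]
      _ = X * Y⁻¹ := by
          rw [← hs, ← mul_assoc, Matrix.nonsing_inv_mul _ hYT, one_mul]
  · have hu : Y *ᵥ (Y⁻¹ *ᵥ w) = w := by
      rw [Matrix.mulVec_mulVec, Matrix.mul_nonsing_inv _ hY, Matrix.one_mulVec]
    have h1 := hle (Y⁻¹ *ᵥ w)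
    rw [hu, Matrix.mulVec_mulVec (M := X)] at h1
    refine lt_of_lt_of_le ?_ (by simpa using h1)
    have hne : Y⁻¹ *ᵥ w ≠ 0 := fun h0 => hw (by rw [← hu, h0, Matrix.mulVec_zero])
    simpa using hΓ.dotProduct_mulVec_pos hne

theorem hasDerivAt_riccati (hΓ : Γ.PosDef) (hW : W.PosSemidef) (hK : K.PosSemidef) {t : ℝ}
    (ht : 0 ≤ t) :
    HasDerivAt (riccati A Γ W K) (A * riccati A Γ W K t + riccati A Γ W K t * Aᵀ -
      riccati A Γ W K t * K * riccati A Γ W K t + W) t := by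
  have hYu := isUnit_hamY (A := A) hΓ hW hK ht
  have hY := (Matrix.isUnit_iff_isUnit_det _).1 hYu
  have h := (hasDerivAt_hamX A Γ W K t).mul (hasDerivAt_matrix_inv (hasDerivAt_hamY A Γ W K t) hYu)
  refine HasDerivAt.congr_deriv h ?_
  rw [riccati]
  have e := Matrix.mul_nonsing_inv _ hY
  generalize hamX A Γ W K t = X at *
  generalize hamY A Γ W K t = Y at *
  simp only [add_mul, mul_sub, sub_mul, neg_sub, mul_assoc, e, mul_one]
  abel

theorem hasDerivAt_riccati_inv (hΓ : Γ.PosDef) (hW : W.PosSemidef) (hK : K.PosSemidef) {t : ℝ}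
    (ht : 0 ≤ t) :
    HasDerivAt (fun s => (riccati A Γ W K s)⁻¹) (K - Aᵀ * (riccati A Γ W K t)⁻¹ -
      (riccati A Γ W K t)⁻¹ * A - (riccati A Γ W K t)⁻¹ * W * (riccati A Γ W K t)⁻¹) t := by
  have hu := (riccati_posDef (A := A) hΓ hW hK ht).isUnit
  have hd := (Matrix.isUnit_iff_isUnit_det _).1 hu
  have h := hasDerivAt_matrix_inv (hasDerivAt_riccati (A := A) hΓ hW hK ht) hu
  refine HasDerivAt.congr_deriv h ?_
  have e := Matrix.mul_nonsing_inv _ hd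
  have e' := Matrix.nonsing_inv_mul _ hd
  have e2 : ∀ G, (riccati A Γ W K t)⁻¹ * (riccati A Γ W K t * G) = G := fun G => by
    rw [← mul_assoc, e', one_mul]
  simp only [add_mul, mul_add, mul_sub, sub_mul, mul_assoc, e, e2, mul_one]
  abel

/-- `Y⁻ᵀ` is the fundamental matrix of the closed-loop filter equation `e' = (A - Π K) e`; this is
what makes the filter explicit. -/
theorem hasDerivAt_hamY_inv_transpose (hΓ : Γ.PosDef) (hW : W.PosSemidef) (hK : K.PosSemidef)
    {t : ℝ} (ht : 0 ≤ t) :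
    HasDerivAt (fun s => ((hamY A Γ W K s)⁻¹)ᵀ)
      ((A - riccati A Γ W K t * K) * ((hamY A Γ W K t)⁻¹)ᵀ) t := by
  have hYu := isUnit_hamY (A := A) hΓ hW hK ht
  have hY := (Matrix.isUnit_iff_isUnit_det _).1 hYu
  have h := hasDerivAt_transpose (hasDerivAt_matrix_inv (hasDerivAt_hamY A Γ W K t) hYu)
  refine HasDerivAt.congr_deriv h ?_
  have hs : (riccati A Γ W K t)ᵀ = riccati A Γ W K t := by
    exact Matrix.isHermitian_iff_isSymm.1 (riccati_posDef (A := A) hΓ hW hK ht).isHermitian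
  have hKs : Kᵀ = K := Matrix.isHermitian_iff_isSymm.1 hK.isHermitian
  rw [← hs, riccati]
  have e := Matrix.mul_nonsing_inv _ hY
  generalize hamX A Γ W K t = X at *
  generalize hamY A Γ W K t = Y at *
  have e' : Y⁻¹ᵀ * Yᵀ = 1 := by rw [← Matrix.transpose_mul, e, Matrix.transpose_one]
  have e2 : ∀ G, Y⁻¹ᵀ * (Yᵀ * G) = G := fun G => by rw [← mul_assoc, e', one_mul]
  simp only [Matrix.transpose_mul, Matrix.transpose_sub, Matrix.transpose_neg, hKs,
    Matrix.transpose_transpose, sub_mul, mul_sub, mul_assoc, e2]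
  abel

/-- The Riccati equation has only one solution. -/
theorem eq_riccati (hΓ : Γ.PosDef) (hW : W.PosSemidef) (hK : K.PosSemidef) {T : ℝ}
    {P : ℝ → Matrix (Fin n) (Fin n) ℝ} (h0 : P 0 = Γ)
    (hP : ∀ t ∈ Icc 0 T, HasDerivWithinAt P (A * P t + P t * Aᵀ - P t * K * P t + W) (Icc 0 T) t)
    {t : ℝ} (ht : t ∈ Icc 0 T) : P t = riccati A Γ W K t := by
  have hPc : ContinuousOn P (Icc 0 T) := fun s hs => (hP s hs).continuousWithinAt
  -- The defect `P Y - X` solves a linear equation whose coefficient `A - P K` is bounded on `[0,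
  -- T]`, and it starts at zero; Gronwall's inequality makes it vanish.
  have hd : ∀ s ∈ Icc 0 T, HasDerivWithinAt (fun s => P s * hamY A Γ W K s - hamX A Γ W K s)
      ((A - P s * K) * (P s * hamY A Γ W K s - hamX A Γ W K s)) (Icc 0 T) s := fun s hs => by
    have h := ((hP s hs).mul (hasDerivAt_hamY A Γ W K s).hasDerivWithinAt).sub
      (hasDerivAt_hamX A Γ W K s).hasDerivWithinAt
    refine HasDerivWithinAt.congr_deriv h ?_
    noncomm_ring
  obtain ⟨L, hL⟩ := isCompact_Icc.exists_bound_of_continuousOn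
    (continuousOn_const.sub (hPc.mul continuousOn_const) : ContinuousOn (fun s => A - P s * K) _)
  have hz := eq_zero_of_abs_deriv_le_mul_abs_self_of_eq_zero_right (K := L)
    (fun s hs => (hd s hs).continuousWithinAt)
    (fun s hs => (hd s (Ico_subset_Icc_self hs)).mono_of_mem_nhdsWithin (Icc_mem_nhdsGE_of_mem hs))
    (by rw [h0, hamX_zero, hamY_zero, mul_one, sub_self])
    (fun s hs => (norm_mul_le _ _).trans
      (mul_le_mul_of_nonneg_right (hL s (Ico_subset_Icc_self hs)) (norm_nonneg _))) t ht
  have hY := (Matrix.isUnit_iff_isUnit_det _).1 (isUnit_hamY (A := A) hΓ hW hK ht.1)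
  rw [riccati, ← sub_eq_zero.1 hz, mul_assoc, Matrix.mul_nonsing_inv _ hY, mul_one]

end Definite

/-! ### The Kalman filter through the Hamiltonian flow. -/

theorem wnorm_sq {d : ℕ} {G : Matrix (Fin d) (Fin d) ℝ} (hG : G.PosSemidef) (x : Fin d → ℝ) :
    wnorm G x ^ 2 = x ⬝ᵥ (G *ᵥ x) :=
  Real.sq_sqrt (by simpa using hG.dotProduct_mulVec_nonneg x)

theorem dotProduct_mulVec_symm {d : ℕ} {G : Matrix (Fin d) (Fin d) ℝ} (hG : Gᵀ = G)
    (x z : Fin d → ℝ) : x ⬝ᵥ (G *ᵥ z) = (G *ᵥ x) ⬝ᵥ z := by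
  rw [Matrix.dotProduct_mulVec, ← Matrix.mulVec_transpose, hG]

theorem mulVec_dotProduct {p q : ℕ} (G : Matrix (Fin p) (Fin q) ℝ) (x : Fin q → ℝ)
    (z : Fin p → ℝ) : (G *ᵥ x) ⬝ᵥ z = x ⬝ᵥ (Gᵀ *ᵥ z) := by
  rw [Matrix.dotProduct_mulVec, Matrix.vecMul_transpose]

/-- The three covariance matrices are positive definite. -/
def SystemData.IsPosDef {n m r : ℕ} (S : SystemData n m r) : Prop :=
  S.Γ.PosDef ∧ S.R.PosDef ∧ S.Q.PosDef

namespace Setting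

variable {n m r : ℕ} (D : Setting n m r) (S : SystemData n m r)

/-- The covariance `B R Bᵀ` of the disturbance of the state equation. -/
def noise : Matrix (Fin n) (Fin n) ℝ := D.B * S.R * D.Bᵀ

/-- The information `Cᵀ Q⁻¹ C` gained by the measurement. -/
noncomputable def info : Matrix (Fin n) (Fin n) ℝ := D.Cᵀ * S.Q⁻¹ * D.C

/-- The first component of the Hamiltonian flow. -/
noncomputable def flowX : ℝ → Matrix (Fin n) (Fin n) ℝ := hamX S.A S.Γ (D.noise S) (D.info S)

/-- The second component of the Hamiltonian flow. -/
noncomputable def flowY : ℝ → Matrix (Fin n) (Fin n) ℝ := hamY S.A S.Γ (D.noise S) (D.info S)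

/-- The error covariance, given by the Hamiltonian flow. -/
noncomputable def cov : ℝ → Matrix (Fin n) (Fin n) ℝ := riccati S.A S.Γ (D.noise S) (D.info S)

variable {D S}

theorem noise_posSemidef (hS : S.IsPosDef) : (D.noise S).PosSemidef := by
  have := hS.2.1.posSemidef.mul_mul_conjTranspose_same D.B
  rwa [Matrix.conjTranspose_eq_transpose_of_trivial] at this

theorem info_posSemidef (hS : S.IsPosDef) : (D.info S).PosSemidef := by
  have := hS.2.2.inv.posSemidef.conjTranspose_mul_mul_same D.C
  rwa [Matrix.conjTranspose_eq_transpose_of_trivial] at this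

theorem cov_posDef (hS : S.IsPosDef) {t : ℝ} (ht : 0 ≤ t) : (D.cov S t).PosDef :=
  riccati_posDef hS.1 (noise_posSemidef hS) (info_posSemidef hS) ht

theorem cov_symm (hS : S.IsPosDef) {t : ℝ} (ht : 0 ≤ t) : (D.cov S t)ᵀ = D.cov S t :=
  Matrix.isHermitian_iff_isSymm.1 (cov_posDef hS ht).isHermitian

theorem cov_inv_symm (hS : S.IsPosDef) {t : ℝ} (ht : 0 ≤ t) : (D.cov S t)⁻¹ᵀ = (D.cov S t)⁻¹ :=
  Matrix.isHermitian_iff_isSymm.1 (cov_posDef hS ht).inv.isHermitian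

theorem isUnit_det_flowX (hS : S.IsPosDef) {t : ℝ} (ht : 0 ≤ t) : IsUnit (D.flowX S t).det :=
  (Matrix.isUnit_iff_isUnit_det _).1
    (isUnit_hamX hS.1 (noise_posSemidef hS) (info_posSemidef hS) ht)

theorem isUnit_det_flowY (hS : S.IsPosDef) {t : ℝ} (ht : 0 ≤ t) : IsUnit (D.flowY S t).det :=
  (Matrix.isUnit_iff_isUnit_det _).1
    (isUnit_hamY hS.1 (noise_posSemidef hS) (info_posSemidef hS) ht)

theorem cov_eq (t : ℝ) : D.cov S t = D.flowX S t * (D.flowY S t)⁻¹ := rfl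

theorem cov_inv_eq (hS : S.IsPosDef) {t : ℝ} (ht : 0 ≤ t) :
    (D.cov S t)⁻¹ = D.flowY S t * (D.flowX S t)⁻¹ :=
  riccati_inv hS.1 (noise_posSemidef hS) (info_posSemidef hS) ht

theorem cov_zero : D.cov S 0 = S.Γ := by
  rw [cov_eq, flowX, flowY, hamX_zero, hamY_zero, inv_one, mul_one]

theorem continuous_flowX : Continuous (D.flowX S) :=
  continuous_iff_continuousAt.2 fun t => (hasDerivAt_hamX _ _ _ _ t).continuousAt

theorem continuous_flowY : Continuous (D.flowY S) :=
  continuous_iff_continuousAt.2 fun t => (hasDerivAt_hamY _ _ _ _ t).continuousAt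

theorem continuousOn_cov (hS : S.IsPosDef) (T : ℝ) : ContinuousOn (D.cov S) (Icc 0 T) :=
  fun _ ht => (hasDerivAt_riccati hS.1 (noise_posSemidef hS) (info_posSemidef hS)
    ht.1).continuousAt.continuousWithinAt

theorem continuousOn_cov_inv (hS : S.IsPosDef) (T : ℝ) :
    ContinuousOn (fun t => (D.cov S t)⁻¹) (Icc 0 T) :=
  fun _ ht => (hasDerivAt_riccati_inv hS.1 (noise_posSemidef hS) (info_posSemidef hS)
    ht.1).continuousAt.continuousWithinAt

theorem continuousOn_flowY_inv (hS : S.IsPosDef) (T : ℝ) :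
    ContinuousOn (fun t => (D.flowY S t)⁻¹) (Icc 0 T) :=
  fun t ht => (hasDerivAt_matrix_inv (hasDerivAt_hamY _ _ _ _ t)
    (isUnit_hamY hS.1 (noise_posSemidef hS) (info_posSemidef hS)
      ht.1)).continuousAt.continuousWithinAt

theorem isRiccatiSolution_errorCov (hS : S.IsPosDef) :
    D.IsRiccatiSolution S (D.errorCov S) := by
  refine Classical.epsilon_spec (p := D.IsRiccatiSolution S) ⟨D.cov S, cov_zero, fun t ht => ?_⟩
  refine ((hasDerivAt_riccati hS.1 (noise_posSemidef hS) (info_posSemidef hS)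
    ht.1).hasDerivWithinAt).congr_deriv ?_
  simp only [cov, info, Matrix.mul_assoc, noise]

/-- `errorCov` is an arbitrary choice among solutions, so uniqueness identifies it with the flow
formula only on `[0, T]`. -/
theorem errorCov_eq_cov (hS : S.IsPosDef) {t : ℝ} (ht : t ∈ Icc 0 D.T) :
    D.errorCov S t = D.cov S t := by
  have h := isRiccatiSolution_errorCov (D := D) hS
  refine eq_riccati hS.1 (noise_posSemidef hS) (info_posSemidef hS) h.1 (fun s hs => ?_) ht
  refine (h.2 s hs).congr_deriv ?_
  simp only [info, Matrix.mul_assoc, noise]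

theorem precision_eq (hS : S.IsPosDef) {t : ℝ} (ht : t ∈ Icc 0 D.T) :
    D.precision S t = (D.cov S t)⁻¹ := by
  rw [precision, errorCov_eq_cov hS ht]

variable (D S) in
/-- The accumulated measurements `x₀ + ∫ Xᵀ Cᵀ Q⁻¹ y`. -/
noncomputable def innov (t : ℝ) : Fin n → ℝ :=
  D.x₀ + ∫ τ in (0 : ℝ)..t, ((D.flowX S τ)ᵀ * (D.Cᵀ * S.Q⁻¹)) *ᵥ D.y τ

variable (D S) in
/-- The Kalman filter, given by the Hamiltonian flow. -/
noncomputable def filter (t : ℝ) : Fin n → ℝ := (D.flowY S t)⁻¹ᵀ *ᵥ D.innov S t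

theorem hasH1Deriv_innov (hy : MemL2 0 D.T D.y) :
    HasH1Deriv 0 D.T (D.innov S)
      (fun τ => ((D.flowX S τ)ᵀ * (D.Cᵀ * S.Q⁻¹)) *ᵥ D.y τ) := by
  refine ⟨MemL2.mulVec ?_ hy, fun s _ => by simp [innov]⟩
  exact (continuous_flowX.matrix_transpose.matrix_mul continuous_const).continuousOn

/-- Variation of constants: differentiating `Y⁻ᵀ` yields `(A - Π K) x̂`, and `Y⁻ᵀ Xᵀ = Π` turns the
derivative of the accumulated measurements into `Π Cᵀ Q⁻¹ y`. -/
theorem isPrimitiveOn_filter (hT : 0 ≤ D.T) (hS : S.IsPosDef) (hy : MemL2 0 D.T D.y) (i : Fin n) :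
    IsPrimitiveOn 0 D.T (fun t => D.filter S t i)
      (fun t => (S.A *ᵥ D.filter S t +
        (D.cov S t * D.Cᵀ * S.Q⁻¹) *ᵥ (D.y t - D.C *ᵥ D.filter S t)) i) := by
  have hΨ : ∀ s ∈ Icc 0 D.T, HasDerivAt (fun s => (D.flowY S s)⁻¹ᵀ)
      ((S.A - D.cov S s * D.info S) * (D.flowY S s)⁻¹ᵀ) s := fun s hs =>
    hasDerivAt_hamY_inv_transpose hS.1 (noise_posSemidef hS) (info_posSemidef hS) hs.1
  have hc : ContinuousOn (fun s => (S.A - D.cov S s * D.info S) * (D.flowY S s)⁻¹ᵀ)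
      (Icc 0 D.T) :=
    (continuousOn_const.sub ((continuousOn_cov hS D.T).mul continuousOn_const)).mul
      fun s hs => (hΨ s hs).continuousAt.continuousWithinAt
  refine (IsPrimitiveOn.mulVec hT (isPrimitiveOn_entry hT hΨ hc)
    ((hasH1Deriv_innov hy).isPrimitiveOn hT) i).congr hT (fun s _ => rfl) fun s hs => ?_
  have e : D.cov S s = (D.flowY S s)⁻¹ᵀ * (D.flowX S s)ᵀ := by
    rw [← cov_symm hS hs.1, cov_eq, Matrix.transpose_mul]
  refine congrFun (?_ : _ = _) i
  have e1 : ((S.A - D.cov S s * D.info S) * (D.flowY S s)⁻¹ᵀ) *ᵥ D.innov S s =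
      (S.A - D.cov S s * D.info S) *ᵥ D.filter S s := (Matrix.mulVec_mulVec ..).symm
  have e2 : (D.flowY S s)⁻¹ᵀ *ᵥ ((D.flowX S s)ᵀ * (D.Cᵀ * S.Q⁻¹)) *ᵥ D.y s =
      (D.cov S s * D.Cᵀ * S.Q⁻¹) *ᵥ D.y s := by
    rw [Matrix.mulVec_mulVec, ← Matrix.mul_assoc, ← e, Matrix.mul_assoc (D.cov S s)]
  rw [e1, e2, Matrix.sub_mulVec, Matrix.mulVec_sub, Matrix.mulVec_mulVec, info]
  simp only [← Matrix.mul_assoc]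
  abel

theorem isKalmanTrajectory_filter (hT : 0 ≤ D.T) (hS : S.IsPosDef) (hy : MemL2 0 D.T D.y) :
    D.IsKalmanTrajectory S (D.filter S) := by
  have hc : ContinuousOn (D.filter S) (Icc 0 D.T) :=
    continuousOn_pi.2 fun i => (isPrimitiveOn_filter hT hS hy i).continuousOn hT
  have hE : ContinuousOn (D.errorCov S) (Icc 0 D.T) :=
    (continuousOn_cov hS D.T).congr fun s hs => errorCov_eq_cov hS hs
  refine ⟨?_, HasH1Deriv.of_isPrimitiveOn hT ?_ fun i =>
    (isPrimitiveOn_filter hT hS hy i).congr hT (fun s _ => rfl) fun s hs => ?_⟩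
  · simp [filter, innov, flowY, hamY_zero]
  · refine ((MemL2.of_continuousOn hc).mulVec continuousOn_const).add (MemL2.mulVec ?_ (hy.sub
      ((MemL2.of_continuousOn hc).mulVec continuousOn_const)))
    exact ((continuous_id.matrix_mul continuous_const).matrix_mul
      continuous_const).comp_continuousOn hE
  · rw [errorCov_eq_cov hS hs]

theorem isKalmanTrajectory_kalmanFilter (hT : 0 ≤ D.T) (hS : S.IsPosDef)
    (hy : MemL2 0 D.T D.y) : D.IsKalmanTrajectory S (D.kalmanFilter S) :=
  Classical.epsilon_spec (p := D.IsKalmanTrajectory S) ⟨_, isKalmanTrajectory_filter hT hS hy⟩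

/-- For any trajectory `x` of the filter equation, the derivative of `Yᵀ x` is `Xᵀ Cᵀ Q⁻¹ y`, in
which `x` no longer occurs. Hence `Yᵀ x` is the accumulated measurement, and `x` is unique. -/
theorem kalmanFilter_eq_filter (hT : 0 ≤ D.T) (hS : S.IsPosDef) (hy : MemL2 0 D.T D.y) {t : ℝ}
    (ht : t ∈ Icc 0 D.T) : D.kalmanFilter S t = D.filter S t := by
  obtain ⟨h0, hx⟩ := isKalmanTrajectory_kalmanFilter hT hS hy
  set x := D.kalmanFilter S
  have hYd : ∀ s ∈ Icc 0 D.T, HasDerivAt (fun s => (D.flowY S s)ᵀ)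
      (D.info S * D.flowX S s - S.Aᵀ * D.flowY S s)ᵀ s := fun s _ =>
    hasDerivAt_transpose (hasDerivAt_hamY _ _ _ _ s)
  have hc : ContinuousOn (fun s => (D.info S * D.flowX S s - S.Aᵀ * D.flowY S s)ᵀ) (Icc 0 D.T) :=
    (((continuous_const.matrix_mul continuous_flowX).sub
      (continuous_const.matrix_mul continuous_flowY)).matrix_transpose).continuousOn
  have hp := IsPrimitiveOn.mulVec hT (isPrimitiveOn_entry hT hYd hc) (hx.isPrimitiveOn hT)
  have hz : (D.flowY S t)ᵀ *ᵥ x t = D.innov S t := by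
    ext i
    have h1 := (hp i).2 t ht
    have h2 := ((hasH1Deriv_innov (S := S) hy).isPrimitiveOn hT i).2 t ht
    refine (h1.trans ?_).trans h2.symm
    congr 1
    · simp [h0, flowY, hamY_zero, innov]
    · refine intervalIntegral.integral_congr fun s hs => ?_
      rw [uIcc_of_le ht.1] at hs
      have hs' : s ∈ Icc 0 D.T := ⟨hs.1, hs.2.trans ht.2⟩
      have e : (D.flowY S s)ᵀ * D.cov S s = (D.flowX S s)ᵀ := by
        rw [← cov_symm hS hs.1, cov_eq, Matrix.transpose_mul, ← mul_assoc, ← Matrix.transpose_mul,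
          Matrix.nonsing_inv_mul _ (isUnit_det_flowY hS hs.1), Matrix.transpose_one, one_mul]
      have e2 : (D.info S)ᵀ = D.info S :=
        Matrix.isHermitian_iff_isSymm.1 (info_posSemidef hS).isHermitian
      refine congrFun (?_ : _ = _) i
      rw [errorCov_eq_cov hS hs', Matrix.mulVec_add, Matrix.mulVec_mulVec, Matrix.mulVec_mulVec,
        ← Matrix.mul_assoc, ← Matrix.mul_assoc, e, Matrix.mulVec_sub, Matrix.mulVec_mulVec,
        Matrix.transpose_sub, Matrix.transpose_mul, Matrix.transpose_mul,
        Matrix.transpose_transpose, Matrix.sub_mulVec, e2, info]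
      simp only [← Matrix.mul_assoc]
      abel
  rw [filter, ← hz, Matrix.mulVec_mulVec, ← Matrix.transpose_mul,
    Matrix.mul_nonsing_inv _ (isUnit_det_flowY hS ht.1), Matrix.transpose_one, Matrix.one_mulVec]

end Setting

/-! ### The value function is quadratic. -/

/-- Completion of squares: the derivative of `‖e‖²_P` along a disturbed trajectory. -/
theorem completion_of_squares {n m r : ℕ} {A P N : Matrix (Fin n) (Fin n) ℝ}
    {B : Matrix (Fin n) (Fin m) ℝ} {C : Matrix (Fin r) (Fin n) ℝ} {R : Matrix (Fin m) (Fin m) ℝ}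
    {q : Matrix (Fin r) (Fin r) ℝ} (hP : Pᵀ = P) (hNP : N * P = 1) (hN : Nᵀ = N) (hR : R.PosDef)
    (hq : qᵀ = q) (x k e : Fin n → ℝ) (v : Fin m → ℝ) (y : Fin r → ℝ) (he : e = x - k) :
    ((A *ᵥ x + B *ᵥ v) - (A *ᵥ k + (N * Cᵀ * q) *ᵥ (y - C *ᵥ k))) ⬝ᵥ (P *ᵥ e) +
        e ⬝ᵥ ((Cᵀ * q * C - Aᵀ * P - P * A - P * (B * R * Bᵀ) * P) *ᵥ e +
          P *ᵥ ((A *ᵥ x + B *ᵥ v) - (A *ᵥ k + (N * Cᵀ * q) *ᵥ (y - C *ᵥ k)))) =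
      v ⬝ᵥ (R⁻¹ *ᵥ v) + (y - C *ᵥ x) ⬝ᵥ (q *ᵥ (y - C *ᵥ x)) -
        (y - C *ᵥ k) ⬝ᵥ (q *ᵥ (y - C *ᵥ k)) -
        (v - R *ᵥ (Bᵀ *ᵥ (P *ᵥ e))) ⬝ᵥ (R⁻¹ *ᵥ (v - R *ᵥ (Bᵀ *ᵥ (P *ᵥ e)))) := by
  have hRu : IsUnit R.det := (Matrix.isUnit_iff_isUnit_det _).1 hR.isUnit
  have hRs : Rᵀ = R := Matrix.isHermitian_iff_isSymm.1 hR.isHermitian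
  have hx : C *ᵥ x = C *ᵥ k + C *ᵥ e := by rw [he, Matrix.mulVec_sub]; abel
  have hAe : A *ᵥ x = A *ᵥ k + A *ᵥ e := by rw [he, Matrix.mulVec_sub]; abel
  clear he
  set f := y - C *ᵥ k with hf
  have hyx : y - C *ᵥ x = f - C *ᵥ e := by rw [hx, hf]; abel
  set p := P *ᵥ e with hp
  set u := Bᵀ *ᵥ p with hu
  have h1 : (A *ᵥ x + B *ᵥ v) - (A *ᵥ k + (N * Cᵀ * q) *ᵥ f) =
      A *ᵥ e + B *ᵥ v - (N * Cᵀ * q) *ᵥ f := by rw [hAe]; abel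
  have h2 : ((N * Cᵀ * q) *ᵥ f) ⬝ᵥ p = (C *ᵥ e) ⬝ᵥ (q *ᵥ f) := by
    rw [Matrix.mul_assoc, ← Matrix.mulVec_mulVec, mulVec_dotProduct, hN, hp, Matrix.mulVec_mulVec,
      hNP, Matrix.one_mulVec, ← Matrix.mulVec_mulVec, mulVec_dotProduct, Matrix.transpose_transpose,
      dotProduct_comm]
  have h3 : (B *ᵥ v) ⬝ᵥ p = v ⬝ᵥ u := mulVec_dotProduct ..
  have h4 : e ⬝ᵥ ((Cᵀ * q * C - Aᵀ * P - P * A - P * (B * R * Bᵀ) * P) *ᵥ e) =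
      (C *ᵥ e) ⬝ᵥ (q *ᵥ (C *ᵥ e)) - 2 * ((A *ᵥ e) ⬝ᵥ p) - u ⬝ᵥ (R *ᵥ u) := by
    have a1 : e ⬝ᵥ ((Cᵀ * q * C) *ᵥ e) = (C *ᵥ e) ⬝ᵥ (q *ᵥ (C *ᵥ e)) := by
      rw [mulVec_dotProduct, Matrix.mulVec_mulVec, Matrix.mulVec_mulVec, Matrix.mul_assoc]
    have a2 : e ⬝ᵥ ((Aᵀ * P) *ᵥ e) = (A *ᵥ e) ⬝ᵥ p := by
      rw [← Matrix.mulVec_mulVec, ← mulVec_dotProduct]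
    have a3 : e ⬝ᵥ ((P * A) *ᵥ e) = (A *ᵥ e) ⬝ᵥ p := by
      rw [← Matrix.mulVec_mulVec, dotProduct_mulVec_symm hP, dotProduct_comm]
    have a4 : e ⬝ᵥ ((P * (B * R * Bᵀ) * P) *ᵥ e) = u ⬝ᵥ (R *ᵥ u) := by
      rw [hu, ← Matrix.mulVec_mulVec, ← Matrix.mulVec_mulVec, dotProduct_mulVec_symm hP, ← hp,
        mulVec_dotProduct Bᵀ p, Matrix.transpose_transpose, ← Matrix.mulVec_mulVec,
        ← Matrix.mulVec_mulVec]
    rw [Matrix.sub_mulVec, Matrix.sub_mulVec, Matrix.sub_mulVec, dotProduct_sub, dotProduct_sub,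
      dotProduct_sub, a1, a2, a3, a4]
    ring
  have h5 : (C *ᵥ e) ⬝ᵥ (q *ᵥ f) = f ⬝ᵥ (q *ᵥ (C *ᵥ e)) := by
    rw [dotProduct_mulVec_symm hq, dotProduct_comm]
  have h6 : R⁻¹ *ᵥ (R *ᵥ u) = u := by
    rw [Matrix.mulVec_mulVec, Matrix.nonsing_inv_mul _ hRu, Matrix.one_mulVec]
  have h7 : (R *ᵥ u) ⬝ᵥ (R⁻¹ *ᵥ v) = v ⬝ᵥ u := by
    rw [mulVec_dotProduct, hRs, Matrix.mulVec_mulVec, Matrix.mul_nonsing_inv _ hRu,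
      Matrix.one_mulVec, dotProduct_comm]
  rw [h1, hyx, dotProduct_add e, dotProduct_mulVec_symm hP e (A *ᵥ e + B *ᵥ v - _), ← hp, h4,
    dotProduct_comm p, sub_dotProduct, add_dotProduct, h2, h3]
  simp only [Matrix.mulVec_sub, dotProduct_sub, sub_dotProduct, h6, h7, h5]
  rw [dotProduct_comm (R *ᵥ u) u]
  ring

namespace Setting

variable {n m r : ℕ} {D : Setting n m r} {S : SystemData n m r}

variable (D S) in
/-- The energy of the innovations of the filter. -/
noncomputable def residual (t : ℝ) : ℝ :=
  1 / 2 * ∫ s in (0 : ℝ)..t,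
    (D.y s - D.C *ᵥ D.filter S s) ⬝ᵥ (S.Q⁻¹ *ᵥ (D.y s - D.C *ᵥ D.filter S s))

variable (D S) in
/-- The optimal feedback for the error `e` at time `s`. -/
noncomputable def feedback (s : ℝ) (e : Fin n → ℝ) : Fin m → ℝ :=
  S.R *ᵥ (D.Bᵀ *ᵥ ((D.cov S s)⁻¹ *ᵥ e))

theorem continuousOn_filter (hT : 0 ≤ D.T) (hS : S.IsPosDef) (hy : MemL2 0 D.T D.y) :
    ContinuousOn (D.filter S) (Icc 0 D.T) :=
  continuousOn_pi.2 fun i => (isPrimitiveOn_filter hT hS hy i).continuousOn hT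

theorem continuousOn_mulVec {p q : ℕ} {G : ℝ → Matrix (Fin p) (Fin q) ℝ} {x : ℝ → Fin q → ℝ}
    {s : Set ℝ} (hG : ContinuousOn G s) (hx : ContinuousOn x s) :
    ContinuousOn (fun t => G t *ᵥ x t) s :=
  (continuous_fst.matrix_mulVec continuous_snd).comp_continuousOn (hG.prodMk hx)

theorem cov_mul_inv (hS : S.IsPosDef) {t : ℝ} (ht : 0 ≤ t) :
    D.cov S t * (D.cov S t)⁻¹ = 1 :=
  Matrix.mul_nonsing_inv _ ((Matrix.isUnit_iff_isUnit_det _).1 (cov_posDef hS ht).isUnit)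

theorem filter_zero : D.filter S 0 = D.x₀ := by
  simp [filter, innov, flowY, hamY_zero]

/-- The cost of an admissible pair, by completion of squares. -/
theorem cost_eq (hS : S.IsPosDef) (hy : MemL2 0 D.T D.y) {t : ℝ}
    (ht : t ∈ Icc 0 D.T) {ξ : Fin n → ℝ} {x : ℝ → Fin n → ℝ} {v : ℝ → Fin m → ℝ}
    (h : D.Admissible S t ξ x v) :
    D.cost S t x v = 1 / 2 * ((ξ - D.filter S t) ⬝ᵥ ((D.cov S t)⁻¹ *ᵥ (ξ - D.filter S t))) +
      D.residual S t + 1 / 2 * ∫ s in (0 : ℝ)..t,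
        (v s - D.feedback S s (x s - D.filter S s)) ⬝ᵥ
          (S.R⁻¹ *ᵥ (v s - D.feedback S s (x s - D.filter S s))) := by
  obtain ⟨hv, hx, hxt⟩ := h
  have hT : 0 ≤ D.T := ht.1.trans ht.2
  have ht0 := ht.1
  have hsub : Icc 0 t ⊆ Icc 0 D.T := Icc_subset_Icc_right ht.2
  have hkc := (continuousOn_filter hT hS hy).mono hsub
  have hxc := hx.continuousOn ht0
  have hyt := hy.mono ht.2
  set k := D.filter S with hk
  set P : ℝ → Matrix (Fin n) (Fin n) ℝ := fun s => (D.cov S s)⁻¹ with hPdef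
  have hPc : ContinuousOn P (Icc 0 t) := continuousOn_cov_inv hS t
  have hP : ∀ s ∈ Icc 0 t, HasDerivAt P
      (D.info S - S.Aᵀ * P s - P s * S.A - P s * D.noise S * P s) s := fun s hs =>
    hasDerivAt_riccati_inv hS.1 (noise_posSemidef hS) (info_posSemidef hS) hs.1
  have hP'c : ContinuousOn (fun s => D.info S - S.Aᵀ * P s - P s * S.A - P s * D.noise S * P s)
      (Icc 0 t) :=
    ((continuousOn_const.sub (continuousOn_const.mul hPc)).sub
      (hPc.mul continuousOn_const)).sub ((hPc.mul continuousOn_const).mul hPc)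
  have he : ∀ i, IsPrimitiveOn 0 t (fun s => (x s - k s) i)
      (fun s => (S.A *ᵥ x s + D.B *ᵥ v s - (S.A *ᵥ k s +
        (D.cov S s * D.Cᵀ * S.Q⁻¹) *ᵥ (D.y s - D.C *ᵥ k s))) i) := fun i =>
    (hx.isPrimitiveOn ht0 i).sub ((isPrimitiveOn_filter hT hS hy i).mono ht)
  -- The function `e·P e` with `e = x - x̂` is absolutely continuous. Its derivative, rewritten by
  -- `completion_of_squares` and integrated from `0` to `t`, is the whole identity.
  have hq := IsPrimitiveOn.dotProduct ht0 he
    (IsPrimitiveOn.mulVec ht0 (isPrimitiveOn_entry ht0 hP hP'c) he)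
  have hqt := hq.2 t ⟨ht0, le_rfl⟩
  have hPsym : ∀ s ∈ Icc 0 t, (P s)ᵀ = P s := fun s hs => cov_inv_symm hS hs.1
  have hQs : S.Q⁻¹ᵀ = S.Q⁻¹ := Matrix.isHermitian_iff_isSymm.1 hS.2.2.inv.isHermitian
  have hyk : MemL2 0 t (fun s => D.y s - D.C *ᵥ k s) :=
    hyt.sub (.of_continuousOn (continuousOn_mulVec continuousOn_const hkc))
  have hyx : MemL2 0 t (fun s => D.y s - D.C *ᵥ x s) :=
    hyt.sub (.of_continuousOn (continuousOn_mulVec continuousOn_const hxc))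
  have hvf : MemL2 0 t (fun s => v s - D.feedback S s (x s - k s)) :=
    hv.sub (.of_continuousOn (continuousOn_mulVec continuousOn_const
      (continuousOn_mulVec continuousOn_const (continuousOn_mulVec hPc (hxc.sub hkc)))))
  have i1 := hv.intervalIntegrable_dotProduct ht0 (hv.mulVec (continuousOn_const (c := S.R⁻¹)))
  have i2 := hyx.intervalIntegrable_dotProduct ht0 (hyx.mulVec (continuousOn_const (c := S.Q⁻¹)))
  have i3 := hyk.intervalIntegrable_dotProduct ht0 (hyk.mulVec (continuousOn_const (c := S.Q⁻¹)))
  have i4 := hvf.intervalIntegrable_dotProduct ht0 (hvf.mulVec (continuousOn_const (c := S.R⁻¹)))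
  have hint : ∫ s in (0 : ℝ)..t, (wnorm S.R⁻¹ (v s) ^ 2 +
      wnorm S.Q⁻¹ (D.y s - D.C *ᵥ x s) ^ 2) =
      (∫ s in (0 : ℝ)..t, v s ⬝ᵥ (S.R⁻¹ *ᵥ v s)) +
        ∫ s in (0 : ℝ)..t, (D.y s - D.C *ᵥ x s) ⬝ᵥ (S.Q⁻¹ *ᵥ (D.y s - D.C *ᵥ x s)) := by
    rw [← intervalIntegral.integral_add i1 i2]
    refine intervalIntegral.integral_congr fun s _ => ?_
    simp only [wnorm_sq hS.2.1.inv.posSemidef, wnorm_sq hS.2.2.inv.posSemidef]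
  have hsq : ∀ s ∈ uIcc 0 t, _ := fun s hs =>
    have hs' : s ∈ Icc 0 t := by rwa [uIcc_of_le ht0] at hs
    completion_of_squares (A := S.A) (B := D.B) (C := D.C) (hPsym s hs')
      (cov_mul_inv (D := D) hS hs'.1) (cov_symm hS hs'.1) hS.2.1 hQs (x s) (k s) (x s - k s) (v s)
      (D.y s) rfl
  have hmain := (intervalIntegral.integral_congr (μ := volume) hsq).trans
    (intervalIntegral.integral_sub ((i1.add i2).sub i3) i4)
  rw [intervalIntegral.integral_sub (i1.add i2) i3, intervalIntegral.integral_add i1 i2] at hmain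
  have hqt' := hqt.trans (congrArg _ hmain)
  rw [cost, wnorm_sq hS.1.inv.posSemidef, hint, residual]
  simp only [hxt, hPdef, cov_zero, hk, filter_zero] at hqt' ⊢
  simp only [feedback]
  linarith

variable (D S) in
/-- The error of the optimal trajectory that ends at `ξ` at time `t`. -/
noncomputable def optimalError (t : ℝ) (ξ : Fin n → ℝ) (s : ℝ) : Fin n → ℝ :=
  D.flowX S s *ᵥ ((D.flowX S t)⁻¹ *ᵥ (ξ - D.filter S t) +
    (∫ τ in (0 : ℝ)..t, ((D.flowY S τ)⁻¹ * (D.Cᵀ * S.Q⁻¹)) *ᵥ (D.y τ - D.C *ᵥ D.filter S τ)) -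
    ∫ τ in (0 : ℝ)..s, ((D.flowY S τ)⁻¹ * (D.Cᵀ * S.Q⁻¹)) *ᵥ (D.y τ - D.C *ᵥ D.filter S τ))

/-- Under the feedback the error solves `e' = (A + W P) e - Π Cᵀ Q⁻¹ (y - C x̂)`. Since `P = Y X⁻¹`,
the matrix `X` is fundamental for the homogeneous part. Writing `e = X z` leaves `z' = -Y⁻¹ Cᵀ Q⁻¹
(y - C x̂)`, integrated with the end condition `X(t) z(t) = ξ - x̂(t)`. -/
theorem admissible_optimal (hS : S.IsPosDef) (hy : MemL2 0 D.T D.y) {t : ℝ}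
    (ht : t ∈ Icc 0 D.T) (ξ : Fin n → ℝ) :
    D.Admissible S t ξ (fun s => D.filter S s + D.optimalError S t ξ s)
      (fun s => D.feedback S s (D.optimalError S t ξ s)) := by
  have hT : 0 ≤ D.T := ht.1.trans ht.2
  have ht0 := ht.1
  have hsub : Icc 0 t ⊆ Icc 0 D.T := Icc_subset_Icc_right ht.2
  have hkc := (continuousOn_filter hT hS hy).mono hsub
  set z₀ : Fin n → ℝ := (D.flowX S t)⁻¹ *ᵥ (ξ - D.filter S t) +
    (∫ τ in (0 : ℝ)..t, ((D.flowY S τ)⁻¹ * (D.Cᵀ * S.Q⁻¹)) *ᵥ (D.y τ - D.C *ᵥ D.filter S τ))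
    with hz₀
  set g : ℝ → Fin n → ℝ := fun τ =>
    ((D.flowY S τ)⁻¹ * (D.Cᵀ * S.Q⁻¹)) *ᵥ (D.y τ - D.C *ᵥ D.filter S τ) with hg
  have hg2 : MemL2 0 t g := by
    refine MemL2.mulVec ?_ ((hy.mono ht.2).sub
      (.of_continuousOn (continuousOn_mulVec continuousOn_const hkc)))
    exact (continuous_id.matrix_mul continuous_const).comp_continuousOn
      (continuousOn_flowY_inv hS t)
  have hI : HasH1Deriv 0 t (fun s => ∫ τ in (0 : ℝ)..s, g τ) g := ⟨hg2, fun s _ => by simp⟩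
  have hz : ∀ i, IsPrimitiveOn 0 t (fun s => (z₀ - ∫ τ in (0 : ℝ)..s, g τ) i)
      (fun s => (0 - g s) i) := fun i =>
    (IsPrimitiveOn.const (z₀ i)).sub (hI.isPrimitiveOn ht0 i)
  have hX : ∀ s ∈ Icc 0 t, HasDerivAt (D.flowX S) (S.A * D.flowX S s + D.noise S * D.flowY S s) s :=
    fun s _ => hasDerivAt_hamX _ _ _ _ s
  have hXc : ContinuousOn (fun s => S.A * D.flowX S s + D.noise S * D.flowY S s) (Icc 0 t) :=
    ((continuous_const.matrix_mul continuous_flowX).add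
      (continuous_const.matrix_mul continuous_flowY)).continuousOn
  have he : ∀ i, IsPrimitiveOn 0 t (fun s => D.optimalError S t ξ s i) _ := fun i =>
    IsPrimitiveOn.mulVec ht0 (isPrimitiveOn_entry ht0 hX hXc) hz i
  have hec : ContinuousOn (D.optimalError S t ξ) (Icc 0 t) :=
    continuousOn_pi.2 fun i => (he i).continuousOn ht0
  have hvc : ContinuousOn (fun s => D.feedback S s (D.optimalError S t ξ s)) (Icc 0 t) :=
    continuousOn_mulVec continuousOn_const
      (continuousOn_mulVec continuousOn_const (continuousOn_mulVec (continuousOn_cov_inv hS t) hec))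
  refine ⟨.of_continuousOn hvc, HasH1Deriv.of_isPrimitiveOn ht0 ?_ fun i => ?_, ?_⟩
  · exact .of_continuousOn ((continuousOn_mulVec continuousOn_const (hkc.add hec)).add
      (continuousOn_mulVec continuousOn_const hvc))
  · refine (((isPrimitiveOn_filter hT hS hy i).mono ht).add (he i)).congr ht0 (fun s _ => rfl)
      fun s hs => ?_
    refine congrFun (?_ : (_ : Fin n → ℝ) = (_ : Fin n → ℝ) + (_ : Fin n → ℝ)) i
    have hXu := isUnit_det_flowX (D := D) hS hs.1
    have hPe : D.flowY S s *ᵥ (z₀ - ∫ τ in (0 : ℝ)..s, g τ) =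
        (D.cov S s)⁻¹ *ᵥ D.optimalError S t ξ s := by
      rw [cov_inv_eq hS hs.1, optimalError, Matrix.mulVec_mulVec, Matrix.mul_assoc,
        Matrix.nonsing_inv_mul _ hXu, Matrix.mul_one]
    have h1 : (S.A * D.flowX S s + D.noise S * D.flowY S s) *ᵥ (z₀ - ∫ τ in (0 : ℝ)..s, g τ) =
        S.A *ᵥ D.optimalError S t ξ s + D.B *ᵥ D.feedback S s (D.optimalError S t ξ s) := by
      rw [Matrix.add_mulVec, ← Matrix.mulVec_mulVec, ← Matrix.mulVec_mulVec, hPe, feedback, noise,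
        ← Matrix.mulVec_mulVec, ← Matrix.mulVec_mulVec]
      rfl
    have h2 : D.flowX S s *ᵥ (0 - g s) = -((D.cov S s * D.Cᵀ * S.Q⁻¹) *ᵥ
        (D.y s - D.C *ᵥ D.filter S s)) := by
      rw [zero_sub, Matrix.mulVec_neg, hg, Matrix.mulVec_mulVec, ← Matrix.mul_assoc, ← cov_eq,
        Matrix.mul_assoc (D.cov S s)]
    rw [h1, h2, Matrix.mulVec_add]
    abel
  · have hXu := isUnit_det_flowX (D := D) hS ht.1
    change D.filter S t + D.optimalError S t ξ t = ξ
    rw [optimalError, add_sub_cancel_right, Matrix.mulVec_mulVec, Matrix.mul_nonsing_inv _ hXu,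
      Matrix.one_mulVec, add_sub_cancel]

/-- In `cost_eq` only the last integral depends on the chosen pair; it is nonnegative and vanishes
for the feedback trajectory, so the infimum is attained. -/
theorem valueFunction_eq (hS : S.IsPosDef) (hy : MemL2 0 D.T D.y) {t : ℝ}
    (ht : t ∈ Icc 0 D.T) (ξ : Fin n → ℝ) :
    D.valueFunction S t ξ =
      1 / 2 * ((ξ - D.filter S t) ⬝ᵥ ((D.cov S t)⁻¹ *ᵥ (ξ - D.filter S t))) +
        D.residual S t := by
  rw [valueFunction]
  split_ifs with h0
  · subst h0
    rw [wnorm_sq hS.1.inv.posSemidef, cov_zero, filter_zero, residual]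
    simp
  · refine IsLeast.csInf_eq ⟨⟨_, _, admissible_optimal hS hy ht ξ, ?_⟩, ?_⟩
    · rw [cost_eq hS hy ht (admissible_optimal hS hy ht ξ)]
      simp
    · rintro J ⟨x, v, hxv, rfl⟩
      rw [cost_eq hS hy ht hxv]
      have : 0 ≤ ∫ s in (0 : ℝ)..t, (v s - D.feedback S s (x s - D.filter S s)) ⬝ᵥ
          (S.R⁻¹ *ᵥ (v s - D.feedback S s (x s - D.filter S s))) :=
        intervalIntegral.integral_nonneg ht.1 fun s _ => by
          simpa using hS.2.1.inv.posSemidef.dotProduct_mulVec_nonneg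
            (v s - D.feedback S s (x s - D.filter S s))
      linarith

end Setting

/-! ### A calculus of bounded, uniformly Lipschitz functions of the data. -/

theorem SystemData.norm1_nonneg {n m r : ℕ} (S : SystemData n m r) : 0 ≤ S.norm1 := by
  unfold SystemData.norm1
  positivity

/-- The function `F` of the data and the time is bounded for data in `𝒮` and times in `[0, T]`,
and Lipschitz continuous in the data, uniformly in time. -/
def LipBdd {n m r : ℕ} (𝒮 : Set (SystemData n m r)) (T : ℝ) {E : Type*} [NormedAddCommGroup E]
    (F : SystemData n m r → ℝ → E) : Prop :=
  ∃ K, 0 ≤ K ∧ (∀ S ∈ 𝒮, ∀ t ∈ Icc 0 T, ‖F S t‖ ≤ K) ∧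
    ∀ S ∈ 𝒮, ∀ S' ∈ 𝒮, ∀ t ∈ Icc 0 T, ‖F S t - F S' t‖ ≤ K * (S - S').norm1

namespace LipBdd

variable {n m r : ℕ} {𝒮 : Set (SystemData n m r)} {T : ℝ} {E E' G : Type*}
  [NormedAddCommGroup E] [NormedAddCommGroup E'] [NormedAddCommGroup G]
  {F : SystemData n m r → ℝ → E} {F' : SystemData n m r → ℝ → E'}

/-- The constants may be different and of any sign; absolute values merge them into one, since the
set of data may be empty and then forces no sign. -/
theorem of_bounds {K L : ℝ} (h1 : ∀ S ∈ 𝒮, ∀ t ∈ Icc 0 T, ‖F S t‖ ≤ K)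
    (h2 : ∀ S ∈ 𝒮, ∀ S' ∈ 𝒮, ∀ t ∈ Icc 0 T, ‖F S t - F S' t‖ ≤ L * (S - S').norm1) :
    LipBdd 𝒮 T F := by
  refine ⟨|K| + |L|, by positivity, fun S hS t ht => (h1 S hS t ht).trans ?_,
    fun S hS S' hS' t ht => (h2 S hS S' hS' t ht).trans ?_⟩
  · linarith [le_abs_self K, abs_nonneg L]
  · refine mul_le_mul_of_nonneg_right ?_ (SystemData.norm1_nonneg _)
    linarith [le_abs_self L, abs_nonneg K]

theorem const (c : E) : LipBdd 𝒮 T (fun _ _ => c) :=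
  of_bounds (K := ‖c‖) (L := 0) (fun _ _ _ _ => le_rfl) fun _ _ _ _ _ _ => by simp

theorem add {F₂ : SystemData n m r → ℝ → E} (h : LipBdd 𝒮 T F) (h' : LipBdd 𝒮 T F₂) :
    LipBdd 𝒮 T (fun S t => F S t + F₂ S t) := by
  obtain ⟨K, -, h1, h2⟩ := h
  obtain ⟨K', -, h1', h2'⟩ := h'
  refine of_bounds (K := K + K') (L := K + K')
    (fun S hS t ht => (norm_add_le _ _).trans (add_le_add (h1 S hS t ht) (h1' S hS t ht)))
    fun S hS S' hS' t ht => ?_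
  rw [add_sub_add_comm, add_mul]
  exact (norm_add_le _ _).trans (add_le_add (h2 S hS S' hS' t ht) (h2' S hS S' hS' t ht))

theorem prodMk (h : LipBdd 𝒮 T F) (h' : LipBdd 𝒮 T F') :
    LipBdd 𝒮 T (fun S t => (F S t, F' S t)) := by
  obtain ⟨K, -, h1, h2⟩ := h
  obtain ⟨K', -, h1', h2'⟩ := h'
  refine of_bounds (K := max K K') (L := max K K')
    (fun S hS t ht => max_le_max (h1 S hS t ht) (h1' S hS t ht)) fun S hS S' hS' t ht => ?_
  have hn := SystemData.norm1_nonneg (S - S')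
  refine max_le ((h2 S hS S' hS' t ht).trans ?_) ((h2' S hS S' hS' t ht).trans ?_)
  · exact mul_le_mul_of_nonneg_right (le_max_left _ _) hn
  · exact mul_le_mul_of_nonneg_right (le_max_right _ _) hn

/-- Composition with a map that is Lipschitz continuous on bounded sets. -/
theorem comp (h : LipBdd 𝒮 T F) {φ : E → G}
    (hφ : ∀ K, ∃ L, ∀ x y, ‖x‖ ≤ K → ‖y‖ ≤ K → ‖φ x - φ y‖ ≤ L * ‖x - y‖) :
    LipBdd 𝒮 T (fun S t => φ (F S t)) := by
  obtain ⟨K, hK, h1, h2⟩ := h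
  obtain ⟨L, hL⟩ := hφ K
  refine of_bounds (K := ‖φ 0‖ + |L| * K) (L := |L| * K) (fun S hS t ht => ?_)
    fun S hS S' hS' t ht => ?_
  · have e1 := hL (F S t) 0 (h1 S hS t ht) (by simpa using hK)
    rw [sub_zero] at e1
    calc ‖φ (F S t)‖ = ‖φ 0 + (φ (F S t) - φ 0)‖ := by rw [add_sub_cancel]
      _ ≤ ‖φ 0‖ + ‖φ (F S t) - φ 0‖ := norm_add_le _ _
      _ ≤ ‖φ 0‖ + |L| * K := by
        gcongr
        exact e1.trans (mul_le_mul (le_abs_self L) (h1 S hS t ht) (norm_nonneg _) (abs_nonneg L))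
  · refine (hL _ _ (h1 S hS t ht) (h1 S' hS' t ht)).trans ?_
    rw [mul_assoc]
    exact mul_le_mul (le_abs_self L) (h2 S hS S' hS' t ht) (norm_nonneg _) (abs_nonneg L)

theorem linearMap [NormedSpace ℝ E] [NormedSpace ℝ G] [FiniteDimensional ℝ E]
    (h : LipBdd 𝒮 T F) (φ : E →ₗ[ℝ] G) : LipBdd 𝒮 T (fun S t => φ (F S t)) := by
  refine h.comp fun K => ⟨‖φ.toContinuousLinearMap‖, fun x y _ _ => ?_⟩
  rw [← map_sub]
  exact φ.toContinuousLinearMap.le_opNorm (x - y)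

theorem bilin [NormedSpace ℝ E] [NormedSpace ℝ E'] [NormedSpace ℝ G]
    (B : E →L[ℝ] E' →L[ℝ] G) (h : LipBdd 𝒮 T F) (h' : LipBdd 𝒮 T F') :
    LipBdd 𝒮 T (fun S t => B (F S t) (F' S t)) := by
  obtain ⟨K, hK, h1, h2⟩ := h
  obtain ⟨K', hK', h1', h2'⟩ := h'
  refine of_bounds (K := ‖B‖ * K * K') (L := 2 * (‖B‖ * K * K')) (fun S hS t ht => ?_)
    fun S hS S' hS' t ht => ?_
  · refine (B.le_opNorm₂ _ _).trans ?_
    gcongr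
    · exact h1 S hS t ht
    · exact h1' S hS t ht
  · have e : B (F S t) (F' S t) - B (F S' t) (F' S' t) =
        B (F S t - F S' t) (F' S t) + B (F S' t) (F' S t - F' S' t) := by
      simp only [map_sub, sub_apply]
      abel
    have hn := SystemData.norm1_nonneg (S - S')
    have e1 : ‖B (F S t - F S' t) (F' S t)‖ ≤ ‖B‖ * (K * (S - S').norm1) * K' := by
      refine (B.le_opNorm₂ _ _).trans ?_
      gcongr
      · exact h2 S hS S' hS' t ht
      · exact h1' S hS t ht
    have e2 : ‖B (F S' t) (F' S t - F' S' t)‖ ≤ ‖B‖ * K * (K' * (S - S').norm1) := by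
      refine (B.le_opNorm₂ _ _).trans ?_
      gcongr
      · exact h1 S' hS' t ht
      · exact h2' S hS S' hS' t ht
    rw [e]
    refine (norm_add_le _ _).trans ((add_le_add e1 e2).trans (le_of_eq ?_))
    ring

theorem time_smul [NormedSpace ℝ E] (h : LipBdd 𝒮 T F) : LipBdd 𝒮 T (fun S t => t • F S t) := by
  obtain ⟨K, hK, h1, h2⟩ := h
  refine of_bounds (K := T * K) (L := T * K) (fun S hS t ht => ?_) fun S hS S' hS' t ht => ?_
  · rw [norm_smul, Real.norm_of_nonneg ht.1]
    exact mul_le_mul ht.2 (h1 S hS t ht) (norm_nonneg _) (ht.1.trans ht.2)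
  · rw [← smul_sub, norm_smul, Real.norm_of_nonneg ht.1, mul_assoc]
    exact mul_le_mul ht.2 (h2 S hS S' hS' t ht) (norm_nonneg _) (ht.1.trans ht.2)

theorem matrix_mul {a b c : ℕ} {H : SystemData n m r → ℝ → Matrix (Fin a) (Fin b) ℝ}
    {H' : SystemData n m r → ℝ → Matrix (Fin b) (Fin c) ℝ} (h : LipBdd 𝒮 T H)
    (h' : LipBdd 𝒮 T H') : LipBdd 𝒮 T (fun S t => H S t * H' S t) :=
  bilin (LinearMap.mk₂ ℝ
    (fun (X : Matrix (Fin a) (Fin b) ℝ) (Y : Matrix (Fin b) (Fin c) ℝ) => X * Y)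
    Matrix.add_mul (fun _ _ _ => Matrix.smul_mul ..) Matrix.mul_add
    (fun _ _ _ => Matrix.mul_smul ..)).toContinuousBilinearMap h h'

theorem mulVec {a b : ℕ} {H : SystemData n m r → ℝ → Matrix (Fin a) (Fin b) ℝ}
    {x : SystemData n m r → ℝ → Fin b → ℝ} (h : LipBdd 𝒮 T H)
    (h' : LipBdd 𝒮 T x) : LipBdd 𝒮 T (fun S t => H S t *ᵥ x S t) :=
  bilin (mulVecCLM a b) h h'

theorem transpose {a b : ℕ} {H : SystemData n m r → ℝ → Matrix (Fin a) (Fin b) ℝ}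
    (h : LipBdd 𝒮 T H) : LipBdd 𝒮 T (fun S t => (H S t)ᵀ) :=
  h.linearMap (Matrix.transposeLinearEquiv (Fin a) (Fin b) ℝ ℝ).toLinearMap

/-- By `H⁻¹ - H'⁻¹ = H⁻¹ (H' - H) H'⁻¹`, bounds on the inverses suffice and `H` itself need not be
bounded. This matters for `Q`, of which only the inverse is bounded. -/
theorem matrix_inv {a : ℕ} {H : SystemData n m r → ℝ → Matrix (Fin a) (Fin a) ℝ}
    {K K' : ℝ} (hK : 0 ≤ K)
    (h : ∀ S ∈ 𝒮, ∀ S' ∈ 𝒮, ∀ t ∈ Icc 0 T, ‖H S t - H S' t‖ ≤ K * (S - S').norm1)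
    (hu : ∀ S ∈ 𝒮, ∀ t ∈ Icc 0 T, IsUnit (H S t).det)
    (hb : ∀ S ∈ 𝒮, ∀ t ∈ Icc 0 T, ‖(H S t)⁻¹‖ ≤ K') : LipBdd 𝒮 T (fun S t => (H S t)⁻¹) := by
  refine of_bounds (K := K') (L := K' * K * K') hb fun S hS S' hS' t ht => ?_
  have e : (H S t)⁻¹ - (H S' t)⁻¹ = (H S t)⁻¹ * (H S' t - H S t) * (H S' t)⁻¹ := by
    rw [mul_sub, sub_mul, mul_assoc, Matrix.mul_nonsing_inv _ (hu S' hS' t ht), mul_one,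
      Matrix.nonsing_inv_mul _ (hu S hS t ht), one_mul]
  have hK' : 0 ≤ K' := (norm_nonneg _).trans (hb S hS t ht)
  rw [e]
  calc _ ≤ ‖(H S t)⁻¹‖ * ‖H S' t - H S t‖ * ‖(H S' t)⁻¹‖ := by
        refine (norm_mul_le _ _).trans ?_
        gcongr
        exact norm_mul_le _ _
    _ ≤ K' * (K * (S - S').norm1) * K' := by
        have hn := SystemData.norm1_nonneg (S - S')
        gcongr
        · exact hb S hS t ht
        · rw [norm_sub_rev]; exact h S hS S' hS' t ht
        · exact hb S' hS' t ht
    _ = _ := by ring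

/-- The exponential is analytic, hence `C¹`, hence Lipschitz on closed balls, which are convex and
compact. -/
theorem exp {ι : Type*} [Fintype ι] [DecidableEq ι] {H : SystemData n m r → ℝ → Matrix ι ι ℝ}
    (h : LipBdd 𝒮 T H) : LipBdd 𝒮 T (fun S t => NormedSpace.exp (H S t)) := by
  have : CompleteSpace (Matrix ι ι ℝ) := FiniteDimensional.complete ℝ _
  have : ProperSpace (Matrix ι ι ℝ) := FiniteDimensional.proper ℝ _
  refine h.comp fun K => ?_
  have hc : ContDiff ℝ 1 (NormedSpace.exp : Matrix ι ι ℝ → Matrix ι ι ℝ) :=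
    contDiff_iff_contDiffAt.2 fun x => (NormedSpace.exp_analytic (𝕂 := ℝ) x).contDiffAt
  obtain ⟨L, hL⟩ := hc.contDiffOn.exists_lipschitzOnWith one_ne_zero
    (convex_closedBall (0 : Matrix ι ι ℝ) K) (isCompact_closedBall 0 K)
  refine ⟨L, fun x y hx hy => ?_⟩
  exact lipschitzOnWith_iff_norm_sub_le.1 hL (by simpa using hx) (by simpa using hy)

/-- Integration against a fixed integrable function. -/
theorem integral_mulVec {a b : ℕ} {H : SystemData n m r → ℝ → Matrix (Fin a) (Fin b) ℝ}
    (h : LipBdd 𝒮 T H) (hc : ∀ S ∈ 𝒮, ContinuousOn (H S) (Icc 0 T)) {y : ℝ → Fin b → ℝ}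
    (hy : MemL2 0 T y) : LipBdd 𝒮 T (fun S t => ∫ τ in (0 : ℝ)..t, H S τ *ᵥ y τ) := by
  obtain ⟨K, hK, h1, h2⟩ := h
  set c := ‖mulVecCLM a b‖
  -- Linearity in `k` allows a double use: for `H S` with `k = K`, and for `H S - H S'` with `k = K
  -- * (S - S').norm1`.
  have hbound : ∀ (g : ℝ → Matrix (Fin a) (Fin b) ℝ) (k : ℝ), 0 ≤ k →
      (∀ τ ∈ Icc 0 T, ‖g τ‖ ≤ k) → ∀ t ∈ Icc 0 T,
      ‖∫ τ in (0 : ℝ)..t, g τ *ᵥ y τ‖ ≤ c * (∫ τ in (0 : ℝ)..T, ‖y τ‖) * k := by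
    intro g k hk hg t ht
    have hT := ht.1.trans ht.2
    have hyi := (hy.intervalIntegrable hT).norm
    have hyt : IntervalIntegrable (fun τ => ‖y τ‖) volume 0 t :=
      intervalIntegrable_of_mem hyi ht
    have e1 : ‖∫ τ in (0 : ℝ)..t, g τ *ᵥ y τ‖ ≤ ∫ τ in (0 : ℝ)..t, c * k * ‖y τ‖ := by
      refine intervalIntegral.norm_integral_le_of_norm_le ht.1 ?_ (hyt.const_mul _)
      refine Filter.Eventually.of_forall fun τ hτ => ?_
      refine ((mulVecCLM a b).le_opNorm₂ (g τ) (y τ)).trans ?_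
      gcongr
      exact hg τ ⟨hτ.1.le, hτ.2.trans ht.2⟩
    have e2 : ∫ τ in (0 : ℝ)..t, ‖y τ‖ ≤ ∫ τ in (0 : ℝ)..T, ‖y τ‖ :=
      intervalIntegral.integral_mono_interval le_rfl ht.1 ht.2
        (Filter.Eventually.of_forall fun _ => norm_nonneg _) hyi
    rw [intervalIntegral.integral_const_mul] at e1
    calc _ ≤ _ := e1
      _ ≤ c * k * ∫ τ in (0 : ℝ)..T, ‖y τ‖ := by gcongr
      _ = _ := by ring
  refine of_bounds (K := c * (∫ τ in (0 : ℝ)..T, ‖y τ‖) * K)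
    (L := c * (∫ τ in (0 : ℝ)..T, ‖y τ‖) * K) (fun S hS => hbound (H S) K hK (h1 S hS))
    fun S hS S' hS' t ht => ?_
  have hT := ht.1.trans ht.2
  have i1 := intervalIntegrable_of_mem ((hy.mulVec (hc S hS)).intervalIntegrable hT) ht
  have i2 := intervalIntegrable_of_mem ((hy.mulVec (hc S' hS')).intervalIntegrable hT) ht
  rw [← intervalIntegral.integral_sub i1 i2]
  have e := hbound (fun τ => H S τ - H S' τ) (K * (S - S').norm1)
    (mul_nonneg hK (SystemData.norm1_nonneg _)) (h2 S hS S' hS') t ht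
  simp only [Matrix.sub_mulVec] at e
  exact e.trans (le_of_eq (by ring))

end LipBdd

/-- For `w = G⁻¹ u` the hypothesis reads `|w|² ≤ M u·Hw ≤ M ‖H‖ |u| |w|`; divide by `|w|`. -/
theorem norm_inv_le_of_coercive {d : ℕ} {G H : Matrix (Fin d) (Fin d) ℝ} (hG : IsUnit G.det)
    {M : ℝ} (hM : 0 ≤ M) (h : ∀ w, w ⬝ᵥ w ≤ M * ((G *ᵥ w) ⬝ᵥ (H *ᵥ w))) :
    ‖G⁻¹‖ ≤ M * ‖H‖ := by
  rw [Matrix.l2_opNorm_def]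
  refine ContinuousLinearMap.opNorm_le_bound _ (by positivity) fun u => ?_
  obtain ⟨u, rfl⟩ := (WithLp.equiv 2 (Fin d → ℝ)).symm.surjective u
  change ‖WithLp.toLp 2 (G⁻¹ *ᵥ u)‖ ≤ M * ‖H‖ * ‖WithLp.toLp 2 u‖
  set w := G⁻¹ *ᵥ u with hw
  have hGw : G *ᵥ w = u := by
    rw [hw, Matrix.mulVec_mulVec, Matrix.mul_nonsing_inv _ hG, Matrix.one_mulVec]
  have e1 := h w
  rw [hGw, ← norm_toLp_sq] at e1
  have e2 := real_inner_le_norm (WithLp.toLp 2 u) (WithLp.toLp 2 (H *ᵥ w))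
  have e3 : inner ℝ (WithLp.toLp 2 u) (WithLp.toLp 2 (H *ᵥ w)) = u ⬝ᵥ (H *ᵥ w) := by
    simp [EuclideanSpace.inner_eq_star_dotProduct, dotProduct_comm]
  have e4 := Matrix.l2_opNorm_mulVec H (WithLp.toLp 2 w)
  change ‖WithLp.toLp 2 (H *ᵥ w)‖ ≤ _ at e4
  rw [e3] at e2
  have e5 : ‖WithLp.toLp 2 w‖ * ‖WithLp.toLp 2 w‖ ≤
      (M * ‖H‖ * ‖WithLp.toLp 2 u‖) * ‖WithLp.toLp 2 w‖ :=
    calc _ ≤ _ := e1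
      _ ≤ M * (‖WithLp.toLp 2 u‖ * (‖H‖ * ‖WithLp.toLp 2 w‖)) := by
        gcongr
        exact e2.trans (by gcongr)
      _ = _ := by ring
  rcases (norm_nonneg (WithLp.toLp 2 w)).eq_or_lt with h0 | h0
  · rw [← h0]; positivity
  · exact le_of_mul_le_mul_right e5 h0

/-! ### Uniform bounds for the flow, the covariance and the filter. -/

/-- The systems with positive definite covariances and data bounded by `M`. -/
def admissibleData (n m r : ℕ) (M : ℝ) : Set (SystemData n m r) :=
  {S | S.IsPosDef ∧ S.BoundedBy M}

section Data

variable {n m r : ℕ} {M T : ℝ}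

theorem norm_A_sub_le (S S' : SystemData n m r) : ‖S.A - S'.A‖ ≤ (S - S').norm1 := by
  change _ ≤ ‖S.A - S'.A‖ + ‖S.Γ - S'.Γ‖ + ‖S.R - S'.R‖ + ‖S.Q - S'.Q‖
  linarith [norm_nonneg (S.Γ - S'.Γ), norm_nonneg (S.R - S'.R), norm_nonneg (S.Q - S'.Q)]

theorem norm_Γ_sub_le (S S' : SystemData n m r) : ‖S.Γ - S'.Γ‖ ≤ (S - S').norm1 := by
  change _ ≤ ‖S.A - S'.A‖ + ‖S.Γ - S'.Γ‖ + ‖S.R - S'.R‖ + ‖S.Q - S'.Q‖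
  linarith [norm_nonneg (S.A - S'.A), norm_nonneg (S.R - S'.R), norm_nonneg (S.Q - S'.Q)]

theorem norm_R_sub_le (S S' : SystemData n m r) : ‖S.R - S'.R‖ ≤ (S - S').norm1 := by
  change _ ≤ ‖S.A - S'.A‖ + ‖S.Γ - S'.Γ‖ + ‖S.R - S'.R‖ + ‖S.Q - S'.Q‖
  linarith [norm_nonneg (S.Γ - S'.Γ), norm_nonneg (S.A - S'.A), norm_nonneg (S.Q - S'.Q)]

theorem norm_Q_sub_le (S S' : SystemData n m r) : ‖S.Q - S'.Q‖ ≤ (S - S').norm1 := by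
  change _ ≤ ‖S.A - S'.A‖ + ‖S.Γ - S'.Γ‖ + ‖S.R - S'.R‖ + ‖S.Q - S'.Q‖
  linarith [norm_nonneg (S.Γ - S'.Γ), norm_nonneg (S.R - S'.R), norm_nonneg (S.A - S'.A)]

theorem lipBdd_A : LipBdd (admissibleData n m r M) T (fun S _ => S.A) :=
  .of_bounds (L := 1) (fun _ hS _ _ => hS.2.1)
    fun S _ S' _ _ _ => (norm_A_sub_le S S').trans (one_mul _).ge

theorem lipBdd_Γ : LipBdd (admissibleData n m r M) T (fun S _ => S.Γ) :=
  .of_bounds (L := 1) (fun _ hS _ _ => hS.2.2.1)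
    fun S _ S' _ _ _ => (norm_Γ_sub_le S S').trans (one_mul _).ge

theorem lipBdd_R : LipBdd (admissibleData n m r M) T (fun S _ => S.R) :=
  .of_bounds (L := 1) (fun _ hS _ _ => hS.2.2.2.1)
    fun S _ S' _ _ _ => (norm_R_sub_le S S').trans (one_mul _).ge

theorem lipBdd_Q_inv : LipBdd (admissibleData n m r M) T (fun S _ => S.Q⁻¹) := by
  refine LipBdd.matrix_inv (H := fun S _ => S.Q) zero_le_one (fun S _ S' _ _ _ => ?_)
    (fun S hS _ _ => (Matrix.isUnit_iff_isUnit_det _).1 hS.1.2.2.isUnit)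
    fun S hS _ _ => hS.2.2.2.2.2
  exact (norm_Q_sub_le S S').trans (one_mul _).ge

end Data

namespace Setting

variable {n m r : ℕ} (D : Setting n m r) {M : ℝ}

theorem lipBdd_exp_hamiltonian : LipBdd (admissibleData n m r M) D.T
    (fun S t => NormedSpace.exp (t • hamiltonian S.A (D.noise S) (D.info S))) := by
  have hW : LipBdd (admissibleData n m r M) D.T (fun S _ => D.noise S) :=
    ((LipBdd.const D.B).matrix_mul lipBdd_R).matrix_mul (.const D.Bᵀ)
  have hK : LipBdd (admissibleData n m r M) D.T (fun S _ => D.info S) :=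
    ((LipBdd.const D.Cᵀ).matrix_mul lipBdd_Q_inv).matrix_mul (.const D.C)
  -- The Hamiltonian matrix is linear in `(A, W, K)`, so Lipschitz dependence passes to it and then
  -- through the exponential.
  let φ : (Matrix (Fin n) (Fin n) ℝ × Matrix (Fin n) (Fin n) ℝ) × Matrix (Fin n) (Fin n) ℝ →ₗ[ℝ]
      Matrix (Fin n ⊕ Fin n) (Fin n ⊕ Fin n) ℝ :=
    { toFun := fun p => hamiltonian p.1.1 p.1.2 p.2
      map_add' := fun p q => by
        simp [hamiltonian, Matrix.fromBlocks_add, Matrix.transpose_add, add_comm]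
      map_smul' := fun c p => by
        simp [hamiltonian, Matrix.fromBlocks_smul, Matrix.transpose_smul] }
  exact (((lipBdd_A.prodMk hW).prodMk hK).linearMap φ).time_smul.exp

theorem lipBdd_flowX : LipBdd (admissibleData n m r M) D.T D.flowX := by
  let φ₁ : Matrix (Fin n ⊕ Fin n) (Fin n ⊕ Fin n) ℝ →ₗ[ℝ] Matrix (Fin n) (Fin n) ℝ :=
    { toFun := Matrix.toBlocks₁₁, map_add' := fun _ _ => rfl, map_smul' := fun _ _ => rfl }
  let φ₂ : Matrix (Fin n ⊕ Fin n) (Fin n ⊕ Fin n) ℝ →ₗ[ℝ] Matrix (Fin n) (Fin n) ℝ :=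
    { toFun := Matrix.toBlocks₁₂, map_add' := fun _ _ => rfl, map_smul' := fun _ _ => rfl }
  exact ((D.lipBdd_exp_hamiltonian.linearMap φ₁).matrix_mul lipBdd_Γ).add
    (D.lipBdd_exp_hamiltonian.linearMap φ₂)

theorem lipBdd_flowY : LipBdd (admissibleData n m r M) D.T D.flowY := by
  let φ₁ : Matrix (Fin n ⊕ Fin n) (Fin n ⊕ Fin n) ℝ →ₗ[ℝ] Matrix (Fin n) (Fin n) ℝ :=
    { toFun := Matrix.toBlocks₂₁, map_add' := fun _ _ => rfl, map_smul' := fun _ _ => rfl }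
  let φ₂ : Matrix (Fin n ⊕ Fin n) (Fin n ⊕ Fin n) ℝ →ₗ[ℝ] Matrix (Fin n) (Fin n) ℝ :=
    { toFun := Matrix.toBlocks₂₂, map_add' := fun _ _ => rfl, map_smul' := fun _ _ => rfl }
  exact ((D.lipBdd_exp_hamiltonian.linearMap φ₁).matrix_mul lipBdd_Γ).add
    (D.lipBdd_exp_hamiltonian.linearMap φ₂)

/-- The lower bound on `Γ` propagates to all later times with the same constant `M`. -/
theorem flow_coercive (hM : 0 < M) {S : SystemData n m r} (hS : S ∈ admissibleData n m r M)
    {t : ℝ} (ht : 0 ≤ t) (w : Fin n → ℝ) :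
    w ⬝ᵥ w ≤ M * ((D.flowY S t *ᵥ w) ⬝ᵥ (D.flowX S t *ᵥ w)) := by
  refine (dotProduct_le_of_norm_inv_le hS.1.1 hM hS.2.2.2.2.1 w).trans ?_
  gcongr
  exact dotProduct_le_hamY_hamX (noise_posSemidef hS.1) (info_posSemidef hS.1) ht w

/-- Coercivity of the pair `(Y, X)` bounds the inverse of each factor by `M` times the norm of the
other; only the bound on `X` is taken from its Lipschitz lemma, and only the Lipschitz estimate from
that of `Y`. -/
theorem lipBdd_flowY_inv (hM : 0 < M) :
    LipBdd (admissibleData n m r M) D.T (fun S t => (D.flowY S t)⁻¹) := by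
  obtain ⟨K, hK, h1, -⟩ := D.lipBdd_flowX (M := M)
  obtain ⟨L, hL, -, h2⟩ := D.lipBdd_flowY (M := M)
  refine LipBdd.matrix_inv hL h2 (fun S hS t ht => isUnit_det_flowY hS.1 ht.1) (K' := M * K)
    fun S hS t ht => ?_
  refine (norm_inv_le_of_coercive (isUnit_det_flowY hS.1 ht.1) hM.le
    (D.flow_coercive hM hS ht.1)).trans ?_
  gcongr
  exact h1 S hS t ht

theorem lipBdd_flowX_inv (hM : 0 < M) :
    LipBdd (admissibleData n m r M) D.T (fun S t => (D.flowX S t)⁻¹) := by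
  obtain ⟨K, hK, h1, -⟩ := D.lipBdd_flowY (M := M)
  obtain ⟨L, hL, -, h2⟩ := D.lipBdd_flowX (M := M)
  refine LipBdd.matrix_inv hL h2 (fun S hS t ht => isUnit_det_flowX hS.1 ht.1) (K' := M * K)
    fun S hS t ht => ?_
  refine (norm_inv_le_of_coercive (H := D.flowY S t) (isUnit_det_flowX hS.1 ht.1) hM.le
    fun w => ?_).trans ?_
  · rw [dotProduct_comm (D.flowX S t *ᵥ w)]
    exact D.flow_coercive hM hS ht.1 w
  · gcongr
    exact h1 S hS t ht

theorem lipBdd_cov (hM : 0 < M) : LipBdd (admissibleData n m r M) D.T D.cov :=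
  D.lipBdd_flowX.matrix_mul (D.lipBdd_flowY_inv hM)

theorem exists_norm_cov_inv_le (hM : 0 < M) : ∃ K, 0 ≤ K ∧ ∀ S ∈ admissibleData n m r M,
    ∀ t ∈ Icc 0 D.T, ‖(D.cov S t)⁻¹‖ ≤ K := by
  obtain ⟨K, hK, h1, -⟩ := D.lipBdd_flowY.matrix_mul (D.lipBdd_flowX_inv hM)
  refine ⟨K, hK, fun S hS t ht => ?_⟩
  rw [cov_inv_eq hS.1 ht.1]
  exact h1 S hS t ht

theorem lipBdd_filter (hM : 0 < M) (hy : MemL2 0 D.T D.y) :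
    LipBdd (admissibleData n m r M) D.T D.filter := by
  refine (D.lipBdd_flowY_inv hM).transpose.mulVec ((LipBdd.const D.x₀).add ?_)
  refine LipBdd.integral_mulVec (D.lipBdd_flowX.transpose.matrix_mul
    ((LipBdd.const D.Cᵀ).matrix_mul lipBdd_Q_inv)) (fun S _ => ?_) hy
  exact (continuous_flowX.matrix_transpose.matrix_mul continuous_const).continuousOn

end Setting

/-! ### Minimizers of sums of quadratics. -/

/-- A sum of positive definite quadratic functions has exactly one minimizer, and its gradient
vanishes there. -/
theorem exists_unique_min_sum_quadratic {ι : Type*} [Fintype ι] [Nonempty ι] {n : ℕ}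
    {P : ι → Matrix (Fin n) (Fin n) ℝ} (hP : ∀ i, (P i).PosDef) (k : ι → Fin n → ℝ) (ρ : ι → ℝ)
    {c : ℝ} (hc : 0 < c) :
    ∃ η : Fin n → ℝ, ∑ i, P i *ᵥ (η - k i) = 0 ∧
      ∀ ξ, IsMinOn (fun ξ => c * ∑ i, (1 / 2 * ((ξ - k i) ⬝ᵥ (P i *ᵥ (ξ - k i))) + ρ i)) univ ξ ↔
        ξ = η := by
  have hPs : ∀ i, (P i)ᵀ = P i := fun i => Matrix.isHermitian_iff_isSymm.1 (hP i).isHermitian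
  have hsum : (∑ i, P i).PosDef := by
    refine Matrix.PosDef.of_dotProduct_mulVec_pos ?_ fun w hw => ?_
    · exact Matrix.isHermitian_iff_isSymm.2
        (by rw [Matrix.IsSymm, Matrix.transpose_sum]; exact Finset.sum_congr rfl fun i _ => hPs i)
    · rw [Matrix.sum_mulVec, dotProduct_sum]
      exact Finset.sum_pos (fun i _ => (hP i).dotProduct_mulVec_pos hw) Finset.univ_nonempty
  have hu := (Matrix.isUnit_iff_isUnit_det _).1 hsum.isUnit
  -- The minimizer is the precision-weighted mean of the centres.
  set η := (∑ i, P i)⁻¹ *ᵥ ∑ i, P i *ᵥ k i with hη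
  have hgrad : ∑ i, P i *ᵥ (η - k i) = 0 := by
    simp only [Matrix.mulVec_sub, Finset.sum_sub_distrib]
    rw [← Matrix.sum_mulVec, hη, Matrix.mulVec_mulVec, Matrix.mul_nonsing_inv _ hu,
      Matrix.one_mulVec, sub_self]
  -- Exact Taylor expansion at `η`; the linear term drops out because the gradient vanishes there.
  have hexp : ∀ ξ, (c * ∑ i, (1 / 2 * ((ξ - k i) ⬝ᵥ (P i *ᵥ (ξ - k i))) + ρ i)) =
      (c * ∑ i, (1 / 2 * ((η - k i) ⬝ᵥ (P i *ᵥ (η - k i))) + ρ i)) +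
        c * (1 / 2 * ((ξ - η) ⬝ᵥ ((∑ i, P i) *ᵥ (ξ - η)))) := by
    intro ξ
    have h1 : ∀ i, 1 / 2 * ((ξ - k i) ⬝ᵥ (P i *ᵥ (ξ - k i))) + ρ i =
        (1 / 2 * ((η - k i) ⬝ᵥ (P i *ᵥ (η - k i))) + ρ i) +
          1 / 2 * ((ξ - η) ⬝ᵥ (P i *ᵥ (ξ - η))) + (ξ - η) ⬝ᵥ (P i *ᵥ (η - k i)) := by
      intro i
      have e : ξ - k i = (ξ - η) + (η - k i) := by abel
      have e' : (η - k i) ⬝ᵥ (P i *ᵥ (ξ - η)) = (ξ - η) ⬝ᵥ (P i *ᵥ (η - k i)) := by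
        rw [dotProduct_mulVec_symm (hPs i), dotProduct_comm]
      rw [e, Matrix.mulVec_add, add_dotProduct, dotProduct_add, dotProduct_add, e']
      ring
    rw [Finset.sum_congr rfl fun i _ => h1 i, Finset.sum_add_distrib, Finset.sum_add_distrib,
      ← dotProduct_sum, hgrad, dotProduct_zero, ← Finset.mul_sum, ← dotProduct_sum,
      ← Matrix.sum_mulVec]
    ring
  refine ⟨η, hgrad, fun ξ => ⟨fun h => ?_, ?_⟩⟩
  · by_contra hne
    have h1 := h (mem_univ η)
    have h2 : 0 < (ξ - η) ⬝ᵥ ((∑ i, P i) *ᵥ (ξ - η)) := by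
      simpa using hsum.dotProduct_mulVec_pos (sub_ne_zero.2 hne)
    have h3 := hexp ξ
    simp only [mem_ofPred_eq] at h1
    have h4 : 0 < c * (1 / 2 * ((ξ - η) ⬝ᵥ ((∑ i, P i) *ᵥ (ξ - η)))) := by positivity
    linarith
  · rintro rfl ζ -
    have h2 : 0 ≤ (ζ - η) ⬝ᵥ ((∑ i, P i) *ᵥ (ζ - η)) := by
      simpa using hsum.posSemidef.dotProduct_mulVec_nonneg (ζ - η)
    have h3 := hexp ζ
    have h4 : 0 ≤ c * (1 / 2 * ((ζ - η) ⬝ᵥ ((∑ i, P i) *ᵥ (ζ - η)))) := by positivity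
    simp only [mem_ofPred_eq]
    linarith

theorem sq_norm_le_dotProduct {n : ℕ} (w : Fin n → ℝ) : ‖w‖ ^ 2 ≤ w ⬝ᵥ w := by
  have h : ‖w‖ ≤ √(w ⬝ᵥ w) := by
    refine (pi_norm_le_iff_of_nonneg (Real.sqrt_nonneg _)).2 fun i => ?_
    refine Real.le_sqrt_of_sq_le ?_
    rw [Real.norm_eq_abs, sq_abs, sq]
    exact Finset.single_le_sum (f := fun i => w i * w i) (fun j _ => mul_self_nonneg (w j))
      (Finset.mem_univ i)
  calc ‖w‖ ^ 2 ≤ √(w ⬝ᵥ w) ^ 2 := by gcongr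
    _ = w ⬝ᵥ w := Real.sq_sqrt (Finset.sum_nonneg fun i _ => mul_self_nonneg (w i))

/-- The factor `n` counts the terms of the dot product, each bounded by sup norms. A constant
depending on the dimension is harmless here. -/
theorem dotProduct_mulVec_le {n : ℕ} (G : Matrix (Fin n) (Fin n) ℝ) (d u : Fin n → ℝ) :
    d ⬝ᵥ (G *ᵥ u) ≤ n * ‖mulVecCLM n n‖ * ‖G‖ * ‖d‖ * ‖u‖ := by
  have h1 : ∀ i ∈ Finset.univ, d i * (G *ᵥ u) i ≤ ‖d‖ * (‖mulVecCLM n n‖ * ‖G‖ * ‖u‖) := by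
    intro i _
    refine (le_abs_self _).trans ?_
    rw [abs_mul]
    exact mul_le_mul (norm_le_pi_norm d i)
      ((norm_le_pi_norm (G *ᵥ u) i).trans ((mulVecCLM n n).le_opNorm₂ G u))
      (abs_nonneg _) (norm_nonneg _)
  refine (Finset.sum_le_card_nsmul _ _ _ h1).trans (le_of_eq ?_)
  rw [Finset.card_univ, Fintype.card_fin, nsmul_eq_mul]
  ring

/-- The distance of the minimizer of a sum of quadratic functions to a point is bounded by the
mean distance of the minimizers of the summands to that point. -/
theorem norm_sub_le_of_gradient_eq_zero {ι : Type*} [Fintype ι] [Nonempty ι] {n : ℕ}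
    {P : ι → Matrix (Fin n) (Fin n) ℝ} {k : ι → Fin n → ℝ} {η kbar : Fin n → ℝ} {K L : ℝ}
    (hK : 0 < K) (hP : ∀ i w, w ⬝ᵥ w ≤ K * (w ⬝ᵥ (P i *ᵥ w))) (hL : ∀ i, ‖P i‖ ≤ L)
    (h : ∑ i, P i *ᵥ (η - k i) = 0) :
    ‖η - kbar‖ ≤ K * (n * ‖mulVecCLM n n‖ * L) *
      (1 / (Fintype.card ι : ℝ) * ∑ i, ‖k i - kbar‖) := by
  have hN : (0 : ℝ) < Fintype.card ι := by exact_mod_cast Fintype.card_pos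
  have hL0 : 0 ≤ L := (norm_nonneg _).trans (hL (Classical.arbitrary ι))
  set d := η - kbar with hd
  set a := (n : ℝ) * ‖mulVecCLM n n‖ * L with ha
  have ha0 : 0 ≤ a := by positivity
  -- The gradient equation is tested with `d`, after splitting `d = (η - k i) + (k i - kbar)`.
  have hsplit : ∑ i, d ⬝ᵥ (P i *ᵥ d) = ∑ i, d ⬝ᵥ (P i *ᵥ (k i - kbar)) := by
    have e : ∀ i, P i *ᵥ d = P i *ᵥ (η - k i) + P i *ᵥ (k i - kbar) := fun i => by
      rw [← Matrix.mulVec_add, hd]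
      congr 1
      abel
    simp only [e, dotProduct_add, Finset.sum_add_distrib]
    rw [← dotProduct_sum, h, dotProduct_zero, zero_add]
  -- Coercivity of every summand yields `card ι` copies of `‖d‖²`. Dividing by `card ι` turns the
  -- sum on the right into a mean, which makes the constant independent of the number of summands.
  have h1 : Fintype.card ι * ‖d‖ ^ 2 ≤ K * ∑ i, d ⬝ᵥ (P i *ᵥ d) := by
    rw [Finset.mul_sum, ← nsmul_eq_mul, ← Finset.card_univ]
    exact Finset.card_nsmul_le_sum _ _ _ fun i _ => (sq_norm_le_dotProduct d).trans (hP i d)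
  have h2 : ∑ i, d ⬝ᵥ (P i *ᵥ (k i - kbar)) ≤ a * ‖d‖ * ∑ i, ‖k i - kbar‖ := by
    rw [Finset.mul_sum]
    refine Finset.sum_le_sum fun i _ => (dotProduct_mulVec_le _ _ _).trans ?_
    rw [ha]
    gcongr
    exact hL i
  have hs : 0 ≤ ∑ i, ‖k i - kbar‖ := Finset.sum_nonneg fun i _ => norm_nonneg _
  rw [hsplit] at h1
  have h3 : (Fintype.card ι * ‖d‖) * ‖d‖ ≤ (K * a * ∑ i, ‖k i - kbar‖) * ‖d‖ :=
    calc _ = Fintype.card ι * ‖d‖ ^ 2 := by ring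
      _ ≤ _ := h1
      _ ≤ K * (a * ‖d‖ * ∑ i, ‖k i - kbar‖) := by gcongr
      _ = _ := by ring
  rcases (norm_nonneg d).eq_or_lt with h0 | h0
  · rw [← h0]; positivity
  · have h4 := le_of_mul_le_mul_right h3 h0
    rw [one_div, mul_left_comm, le_inv_mul_iff₀ hN]
    exact h4

theorem wnorm_le {n : ℕ} {G : Matrix (Fin n) (Fin n) ℝ} {L : ℝ} (hL : ‖G‖ ≤ L)
    (d : Fin n → ℝ) : wnorm G d ≤ √(n * ‖mulVecCLM n n‖ * L) * ‖d‖ := by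
  have hL0 : 0 ≤ L := (norm_nonneg _).trans hL
  rw [wnorm, Real.sqrt_le_left (by positivity), mul_pow, Real.sq_sqrt (by positivity)]
  refine (dotProduct_mulVec_le G d d).trans ?_
  rw [mul_assoc, ← sq]
  gcongr

/-! ### The estimator and the error bound. -/

theorem SystemData.BoundedBy.mono {n m r : ℕ} {S : SystemData n m r} {M M' : ℝ}
    (h : S.BoundedBy M) (hM : M ≤ M') : S.BoundedBy M' :=
  ⟨h.1.trans hM, h.2.1.trans hM, h.2.2.1.trans hM, h.2.2.2.1.trans hM, h.2.2.2.2.trans hM⟩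

namespace UncertainSystem

variable {n m r : ℕ} (U : UncertainSystem n m r)

theorem isPosDef_data (σ : U.Param) : (U.data σ).IsPosDef :=
  ⟨U.posDef_matΓ _ σ.2.1.2, U.posDef_matR _ σ.2.2.1.2, U.posDef_matQ _ σ.2.2.2.2⟩

theorem nonempty_param : Nonempty U.Param :=
  ⟨⟨_, U.setA_nonempty.choose_spec⟩, ⟨_, U.setΓ_nonempty.choose_spec⟩,
    ⟨_, U.setR_nonempty.choose_spec⟩, ⟨_, U.setQ_nonempty.choose_spec⟩⟩

/-- The expected energy has exactly one minimizer, where its gradient vanishes. -/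
theorem energyEstimator_spec {D : Setting n m r} (hy : MemL2 0 D.T D.y) {t : ℝ}
    (ht : t ∈ Icc 0 D.T) :
    ∑ σ : U.Param, (D.cov (U.data σ) t)⁻¹ *ᵥ (U.energyEstimator D t - D.filter (U.data σ) t) = 0 ∧
      ∀ ξ, U.IsEnergyMinimizer D t ξ ↔ ξ = U.energyEstimator D t := by
  have := U.nonempty_param
  have hN : (0 : ℝ) < 1 / Fintype.card U.Param :=
    one_div_pos.2 (by exact_mod_cast Fintype.card_pos)
  obtain ⟨η, hη, hmin⟩ := exists_unique_min_sum_quadratic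
    (fun σ : U.Param => (Setting.cov_posDef (D := D) (U.isPosDef_data σ) ht.1).inv)
    (fun σ => D.filter (U.data σ) t) (fun σ => D.residual (U.data σ) t) hN
  have hE : U.expectedEnergy D t = fun ξ => 1 / (Fintype.card U.Param : ℝ) * ∑ σ : U.Param,
      (1 / 2 * ((ξ - D.filter (U.data σ) t) ⬝ᵥ
        ((D.cov (U.data σ) t)⁻¹ *ᵥ (ξ - D.filter (U.data σ) t))) + D.residual (U.data σ) t) := by
    ext ξ
    simp only [expectedEnergy, expect]
    congr 1
    exact Finset.sum_congr rfl fun σ _ => Setting.valueFunction_eq (U.isPosDef_data σ) hy ht ξ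
  have hiff : ∀ ξ, U.IsEnergyMinimizer D t ξ ↔ ξ = η := by
    intro ξ
    rw [IsEnergyMinimizer, hE]
    exact hmin ξ
  have hest : U.energyEstimator D t = η :=
    (hiff _).1 (Classical.epsilon_spec (p := U.IsEnergyMinimizer D t) ⟨η, (hiff η).2 rfl⟩)
  rw [hest]
  exact ⟨hη, hiff⟩

end UncertainSystem

end UncertainKalman

/-- The constant `c` depends only on `T, B, C, x₀, y` and on a bound `M` for the data; it depends
neither on the number `N` of parameters nor on the uncertain system or the hidden parameter.
The first two conjuncts say that the filters and the estimator are well defined. -/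
theorem mainTheorem3 {n m r : ℕ} (D : UncertainKalman.Setting n m r) (hT : 0 < D.T)
    (hy : UncertainKalman.MemL2 0 D.T D.y) (M : ℝ) :
    ∃ c : ℝ, 0 < c ∧
      ∀ U : UncertainKalman.UncertainSystem n m r, (∀ σ : U.Param, (U.data σ).BoundedBy M) →
        (∀ σ : U.Param,
          D.IsRiccatiSolution (U.data σ) (D.errorCov (U.data σ)) ∧
          (∀ t ∈ Set.Icc 0 D.T, (D.errorCov (U.data σ) t).PosDef) ∧
          D.IsKalmanTrajectory (U.data σ) (D.kalmanFilter (U.data σ))) ∧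
        (∀ t ∈ Set.Icc 0 D.T, ∀ ξ : Fin n → ℝ,
          U.IsEnergyMinimizer D t ξ ↔ ξ = U.energyEstimator D t) ∧
        ∀ σbar : U.Param, ∀ t ∈ Set.Icc 0 D.T,
          UncertainKalman.wnorm (D.precision (U.data σbar) t)
              (U.energyEstimator D t - D.kalmanFilter (U.data σbar) t)
            ≤ c * U.expect fun σ => (U.data σ - U.data σbar).norm1 := by
  -- `M` is arbitrary and may fail to be positive, which the coercivity lemmas require.
  have hM' : 0 < max M 1 := lt_max_of_lt_right one_pos
  obtain ⟨K, hK, hK1, -⟩ := D.lipBdd_cov hM'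
  obtain ⟨L, hL, hL1⟩ := D.exists_norm_cov_inv_le hM'
  obtain ⟨F, hF, -, hF2⟩ := D.lipBdd_filter hM' hy
  set a : ℝ := n * ‖UncertainKalman.mulVecCLM n n‖ * L with ha
  have ha0 : 0 ≤ a := by positivity
  -- `√a` converts the sup norm into the `P`-norm, `K + 1` is the coercivity constant of the
  -- precisions, the inner `a` bounds their bilinear forms, and `F` is the Lipschitz constant of the
  -- filter. The final `+ 1` ensures positivity.
  refine ⟨√a * ((K + 1) * a * F) + 1, by positivity, fun U hU => ?_⟩
  have hmem : ∀ σ : U.Param, U.data σ ∈ UncertainKalman.admissibleData n m r (max M 1) :=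
    fun σ => ⟨U.isPosDef_data σ, (hU σ).mono (le_max_left _ _)⟩
  have := U.nonempty_param
  refine ⟨fun σ => ⟨UncertainKalman.Setting.isRiccatiSolution_errorCov (U.isPosDef_data σ),
    fun t ht => ?_, UncertainKalman.Setting.isKalmanTrajectory_kalmanFilter hT.le
      (U.isPosDef_data σ) hy⟩, fun t ht => (U.energyEstimator_spec hy ht).2, fun σbar t ht => ?_⟩
  · rw [UncertainKalman.Setting.errorCov_eq_cov (U.isPosDef_data σ) ht]
    exact UncertainKalman.Setting.cov_posDef (U.isPosDef_data σ) ht.1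
  rw [UncertainKalman.Setting.precision_eq (U.isPosDef_data σbar) ht,
    UncertainKalman.Setting.kalmanFilter_eq_filter hT.le (U.isPosDef_data σbar) hy ht]
  -- Coercivity of `P` follows from the bound `K` on its inverse `Π`; `K + 1` is used because `K`
  -- may be zero.
  have hd := UncertainKalman.norm_sub_le_of_gradient_eq_zero (K := K + 1) (L := L)
    (kbar := D.filter (U.data σbar) t) (by positivity)
    (fun σ w => by
      have hu := (Matrix.isUnit_iff_isUnit_det _).1
        (UncertainKalman.Setting.cov_posDef (D := D) (U.isPosDef_data σ) ht.1).isUnit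
      refine UncertainKalman.dotProduct_le_of_norm_inv_le
        (UncertainKalman.Setting.cov_posDef (U.isPosDef_data σ) ht.1).inv (by positivity) ?_ w
      rw [Matrix.nonsing_inv_nonsing_inv _ hu]
      exact (hK1 _ (hmem σ) t ht).trans (by linarith))
    (fun σ => hL1 _ (hmem σ) t ht) (U.energyEstimator_spec hy ht).1
  have hN : (0 : ℝ) ≤ 1 / Fintype.card U.Param := by positivity
  set e := U.expect fun σ => (U.data σ - U.data σbar).norm1 with he
  have he0 : 0 ≤ e :=
    mul_nonneg hN (Finset.sum_nonneg fun σ _ => UncertainKalman.SystemData.norm1_nonneg _)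
  have hmean : 1 / (Fintype.card U.Param : ℝ) *
      ∑ σ : U.Param, ‖D.filter (U.data σ) t - D.filter (U.data σbar) t‖ ≤ F * e := by
    rw [he, UncertainKalman.UncertainSystem.expect, mul_left_comm F, Finset.mul_sum _ _ F]
    exact mul_le_mul_of_nonneg_left
      (Finset.sum_le_sum fun σ _ => hF2 _ (hmem σ) _ (hmem σbar) t ht) hN
  calc _ ≤ √a * ‖U.energyEstimator D t - D.filter (U.data σbar) t‖ :=
        UncertainKalman.wnorm_le (hL1 _ (hmem σbar) t ht) _
    _ ≤ √a * ((K + 1) * a * (F * e)) := by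
        gcongr
        exact hd.trans (by gcongr)
    _ = √a * ((K + 1) * a * F) * e := by ring
    _ ≤ (√a * ((K + 1) * a * F) + 1) * e := by gcongr; linarith
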